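/- Let $\Bbbk$ be a field of characteristic zero. A *double multiplicative Poisson vertex algebra* is a unital associative $\Bbbk$-algebra $\mathcal V$ with an automorphism $S$ of infinite order (extended diagonally to $\mathcal V\otimes\mathcal V$) and a linear map $\mathcal V\otimes\mathcal V\to(\mathcal V\otimes\mathcal V)[\lambda^{\pm1}]$, $a\otimes b\mapsto\{\!\{a_\lambda b\}\!\}=\sum_n\{\!\{a,b\}\!\}_n\lambda^n$, such that, for all $a,b,c\in\mathcal V$, 1. $\{\!\{S(a)_\lambda b\}\!\}=\lambda^{-1}\{\!\{a_\lambda b\}\!\}$ and $\{\!\{a_\lambda S(b)\}\!\}=\lambda S(\{\!\{a_\lambda b\}\!\})$; 2. $\{\!\{a_\lambda bc\}\!\}=\{\!\{a_\lambda b\}\!\}(1\otimes c)+(b\otimes1)\{\!\{a_\lambda c\}\!\}$; 3. $\{\!\{ab_\lambda c\}\!\}=\sum_n\big(\{\!\{a,c\}\!\}_n(S^n(b)\otimes1)+(1\otimes S^n(a))\{\!\{b,c\}\!\}_n\big)\lambda^n$; 4. (skewsymmetry) $\{\!\{a_\lambda b\}\!\}=-\sum_n\lambda^{-n}S^{-n}\big(\{\!\{b,a\}\!\}_n^\sigma\big)$,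 where $(x\otimes y)^\sigma=y\otimes x$; 5. (Jacobi identity) $\{\!\{a_\lambda\{\!\{b_\mu c\}\!\}\}\!\}_L-\{\!\{b_\mu\{\!\{a_\lambda c\}\!\}\}\!\}_R-\{\!\{\{\!\{a_\lambda b\}\!\}_{\lambda\mu}c\}\!\}_L=0$, where $\{\!\{a_\lambda x\otimes y\}\!\}_L=\{\!\{a_\lambda x\}\!\}\otimes y$, $\{\!\{a_\lambda x\otimes y\}\!\}_R=x\otimes\{\!\{a_\lambda y\}\!\}$, and $\{\!\{x\otimes y\,{}_\lambda c\}\!\}_L=\sum_n\lambda^n\,p_n'\otimes S^n(y)\otimes p_n''$ with $\{\!\{x,c\}\!\}_n=p_n'\otimes p_n''$ (sum understood). A map satisfying 1–3 is called a double multiplicative $\lambda$-bracket. Let $\mathcal R_2=\Bbbk\langle u_i,v_i\mid i\in\mathbb Z\rangle$ be the free algebra with the automorphism $S(u_i)=u_{i+1}$, $S(v_i)=v_{i+1}$, and write $u=u_0$, $v=v_0$. Let $k\in\mathbb Z$ and $g\in\mathcal R_2\otimes\mathcal R_2$. There is a unique skewsymmetric double multiplicative $\lambda$-bracket on $\mathcal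 R_2$ with $$\{\!\{u_\lambda u\}\!\}=0,\qquad \{\!\{v_\lambda v\}\!\}=0,\qquad \{\!\{u_\lambda v\}\!\}=g\,\lambda^k .$$ With this bracket, $\mathcal R_2$ is a double multiplicative Poisson vertex algebra if and only if, after a translation $u_i\mapsto u_i+\mu$, $v_i\mapsto v_i+\nu$ (all $i\in\mathbb Z$) with some $\mu,\nu\in\Bbbk$, the element $g$ takes one of the following forms; moreover, exactly one of the five forms can be reached from $g$ by translations: (i) $g=a\,1\otimes1$ with $a\in\Bbbk$; (ii) $g=a\,v\otimes v$ with $a\in\Bbbk^\times$; (iii) $g=a\,u_k\otimes u_k$ with $a\in\Bbbk^\times$; (iv) $g=a\,v\otimes v+b\,(v\otimes u_k+u_k\otimes v)+\frac{b^2}{a}\,u_k\otimes u_k$ with $a,b\in\Bbbk^\times$; (v) $g=a\,vu_k\otimes u_kv+b\,(vu_k\otimes1+1\otimes u_kv)+\frac{b^2}{a}\,1\otimes1$ with $a\in\Bbbk^\times$, $b\in\Bbbk$. -/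

import Mathlib

open scoped TensorProduct

noncomputable section

namespace DoubleMPVA

section General

variable {K : Type*} [Field K] {V : Type*} [Ring V] [Algebra K V]

/-- A linear map `a ⊗ b ↦ {{a_λ b}}` with values in Laurent polynomials in `λ` over `V ⊗ V`.
A Laurent polynomial `∑ pₙ λⁿ` is recorded by its finitely supported family of coefficients
`n ↦ pₙ`. -/
abbrev LambdaMap (K : Type*) [Field K] (V : Type*) [Ring V] [Algebra K V] :=
  V →ₗ[K] V →ₗ[K] (ℤ →₀ V ⊗[K] V)

/-- The coefficient of `λⁿ` in `{{a_λ b}}`, as a bilinear map in `a` and `b`. -/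
def LambdaMap.coeff (B : LambdaMap K V) (n : ℤ) : V →ₗ[K] V →ₗ[K] V ⊗[K] V :=
  B.compr₂ (Finsupp.lapply n)

/-- The outer left action `b (a₁ ⊗ a₂) = b a₁ ⊗ a₂`. -/
def outerLeft (b : V) : V ⊗[K] V →ₗ[K] V ⊗[K] V := (LinearMap.mulLeft K b).rTensor V

/-- The outer right action `(a₁ ⊗ a₂) b = a₁ ⊗ a₂ b`. -/
def outerRight (b : V) : V ⊗[K] V →ₗ[K] V ⊗[K] V := (LinearMap.mulRight K b).lTensor V

/-- The inner left action `b ∗₁ (a₁ ⊗ a₂) = a₁ ⊗ b a₂`. -/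
def innerLeft (b : V) : V ⊗[K] V →ₗ[K] V ⊗[K] V := (LinearMap.mulLeft K b).lTensor V

/-- The inner right action `(a₁ ⊗ a₂) ∗₁ b = a₁ b ⊗ a₂`. -/
def innerRight (b : V) : V ⊗[K] V →ₗ[K] V ⊗[K] V := (LinearMap.mulRight K b).rTensor V

/-- The flip `(a ⊗ b)^σ = b ⊗ a`. -/
def flip : V ⊗[K] V →ₗ[K] V ⊗[K] V := (TensorProduct.comm K V V).toLinearMap

/-- The diagonal action `a ⊗ b ↦ S a ⊗ S b` of an algebra endomorphism on `V ⊗ V`. -/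
def diag (S : V →ₐ[K] V) : V ⊗[K] V →ₗ[K] V ⊗[K] V :=
  TensorProduct.map S.toLinearMap S.toLinearMap

/-- The action of the power `Sⁿ` (`n` an integer) on `V ⊗ V`. -/
def diagPow (S : V ≃ₐ[K] V) (n : ℤ) : V ⊗[K] V →ₗ[K] V ⊗[K] V :=
  diag ((S ^ n : V ≃ₐ[K] V) : V →ₐ[K] V)

/-- Double multiplicative `λ`-brackets on `(V, S)`; each identity between Laurent polynomials
is stated as the equality of the coefficients of `λⁿ`, for all `n`. -/
structure IsLambdaBracket (S : V ≃ₐ[K] V) (B : LambdaMap K V) : Prop where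
  /-- `{{S(a)_λ b}} = λ⁻¹ {{a_λ b}}` -/
  sesq_left : ∀ (a b : V) (n : ℤ), B.coeff n (S a) b = B.coeff (n + 1) a b
  /-- `{{a_λ S(b)}} = λ S({{a_λ b}})` -/
  sesq_right : ∀ (a b : V) (n : ℤ),
    B.coeff n a (S b) = diagPow S 1 (B.coeff (n - 1) a b)
  /-- `{{a_λ bc}} = {{a_λ b}} c + b {{a_λ c}}` -/
  leibniz_left : ∀ (a b c : V) (n : ℤ),
    B.coeff n a (b * c) = outerRight c (B.coeff n a b) + outerLeft b (B.coeff n a c)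
  /-- `{{ab_λ c}} = {{a_{λx} c}} ∗₁ (|_{x=S} b) + (|_{x=S} a) ∗₁ {{b_{λx} c}}` -/
  leibniz_right : ∀ (a b c : V) (n : ℤ),
    B.coeff n (a * b) c =
      innerRight ((S ^ n) b) (B.coeff n a c) + innerLeft ((S ^ n) a) (B.coeff n b c)

/-- Skewsymmetry `{{a_λ b}} = - |_{x=S} {{b_{λ⁻¹x⁻¹} a}}^σ`: the coefficient of `λⁿ` on the
right is `- Sⁿ` applied to the flip of the coefficient of `λ⁻ⁿ` in `{{b_λ a}}`. -/
def IsSkew (S : V ≃ₐ[K] V) (B : LambdaMap K V) : Prop :=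
  ∀ (a b : V) (n : ℤ), B.coeff n a b = - diagPow S n (flip (B.coeff (-n) b a))

/-- The coefficient of `λᵐ` in `{{a_λ A}}_L = {{a_λ A'}} ⊗ A''`. -/
def brL (B : LambdaMap K V) (m : ℤ) (a : V) : V ⊗[K] V →ₗ[K] V ⊗[K] (V ⊗[K] V) :=
  (TensorProduct.assoc K V V V).toLinearMap ∘ₗ (B.coeff m a).rTensor V

/-- The coefficient of `λᵐ` in `{{a_λ A}}_R = A' ⊗ {{a_λ A''}}`. -/
def brR (B : LambdaMap K V) (m : ℤ) (a : V) : V ⊗[K] V →ₗ[K] V ⊗[K] (V ⊗[K] V) :=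
  (B.coeff m a).lTensor V

/-- The map `(a₁ ⊗ a₂) ⊗ b ↦ (a₁ ⊗ a₂) ⊗₁ b = a₁ ⊗ b ⊗ a₂`. -/
def insertMiddle : (V ⊗[K] V) ⊗[K] V →ₗ[K] V ⊗[K] (V ⊗[K] V) :=
  (TensorProduct.comm K V V).toLinearMap.lTensor V ∘ₗ (TensorProduct.assoc K V V V).toLinearMap

/-- The coefficient of `λⁿ` in `{{A_λ c}}_L = {{A'_{λx} c}} ⊗₁ (|_{x=S} A'')`. -/
def brArgL (S : V ≃ₐ[K] V) (B : LambdaMap K V) (n : ℤ) (c : V) :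
    V ⊗[K] V →ₗ[K] V ⊗[K] (V ⊗[K] V) :=
  insertMiddle ∘ₗ
    TensorProduct.map ((B.coeff n).flip c) (S ^ n : V ≃ₐ[K] V).toLinearMap

/-- Jacobi identity
`{{a_λ {{b_μ c}}}}_L - {{b_μ {{a_λ c}}}}_R - {{{{a_λ b}}_{λμ} c}}_L = 0`,
stated for the coefficient of `λᵐ μⁿ`. In the last term the inner bracket contributes `λᵖ` and
the outer one `(λμ)^q`, so that `q = n` and `p = m - n`. -/
def IsJacobi (S : V ≃ₐ[K] V) (B : LambdaMap K V) : Prop :=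
  ∀ (a b c : V) (m n : ℤ),
    brL B m a (B.coeff n b c) - brR B n b (B.coeff m a c)
      - brArgL S B n c (B.coeff (m - n) a b) = 0

/-- `(V, S)` with `B` is a double multiplicative Poisson vertex algebra. -/
structure IsDoubleMPVA (S : V ≃ₐ[K] V) (B : LambdaMap K V) : Prop where
  infinite_order : ¬ IsOfFinOrder S
  bracket : IsLambdaBracket S B
  skew : IsSkew S B
  jacobi : IsJacobi S B

end General

section FreeDifference

variable (K : Type*) [Field K]

/-- Non-commutative difference polynomials in two variables: the free associative algebra on
`u_n = (0, n)` and `v_n = (1, n)`, `n ∈ ℤ`. -/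
abbrev R2 := FreeAlgebra K (Fin 2 × ℤ)

/-- The generator `u_n`; the variable `u` is `u_0`. -/
def u (n : ℤ) : R2 K := FreeAlgebra.ι K (0, n)

/-- The generator `v_n`; the variable `v` is `v_0`. -/
def v (n : ℤ) : R2 K := FreeAlgebra.ι K (1, n)

/-- The endomorphism of `R2` shifting the index of every generator by `r`. -/
def shiftHom (r : ℤ) : R2 K →ₐ[K] R2 K :=
  FreeAlgebra.lift K fun p => FreeAlgebra.ι K (p.1, p.2 + r)

/-- The automorphism `S` with `S(u_n) = u_{n+1}` and `S(v_n) = v_{n+1}`. -/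
def shift : R2 K ≃ₐ[K] R2 K :=
  AlgEquiv.ofAlgHom (shiftHom K 1) (shiftHom K (-1))
    (by ext p; simp [shiftHom]) (by ext p; simp [shiftHom])

variable {K}

/-- The translation `u_n ↦ u_n + μ`, `v_n ↦ v_n + ν` (for all `n`) of `R2`; it is the
algebra endomorphism commuting with `S` with `u ↦ u + μ` and `v ↦ v + ν`. -/
def translation (μ ν : K) : R2 K →ₐ[K] R2 K :=
  FreeAlgebra.lift K fun p => FreeAlgebra.ι K p + algebraMap K (R2 K) (![μ, ν] p.1)

/-- The five normal forms of `g`, numbered from `0` to `4`. -/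
def normalForm (k : ℤ) (g : R2 K ⊗[K] R2 K) : Fin 5 → Prop :=
  ![ ∃ a : K, g = a • (1 ⊗ₜ[K] 1),
     ∃ a : K, a ≠ 0 ∧ g = a • (v K 0 ⊗ₜ[K] v K 0),
     ∃ a : K, a ≠ 0 ∧ g = a • (u K k ⊗ₜ[K] u K k),
     ∃ a b : K, a ≠ 0 ∧ b ≠ 0 ∧
      g = a • (v K 0 ⊗ₜ[K] v K 0) + b • (v K 0 ⊗ₜ[K] u K k + u K k ⊗ₜ[K] v K 0)
        + (b ^ 2 / a) • (u K k ⊗ₜ[K] u K k),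
     ∃ a b : K, a ≠ 0 ∧
      g = a • ((v K 0 * u K k) ⊗ₜ[K] (u K k * v K 0))
        + b • ((v K 0 * u K k) ⊗ₜ[K] 1 + 1 ⊗ₜ[K] (u K k * v K 0))
        + (b ^ 2 / a) • (1 ⊗ₜ[K] 1) ]

/-- `B` is a skewsymmetric double multiplicative `λ`-bracket on `R2` with
`{{u_λ u}} = 0`, `{{v_λ v}} = 0` and `{{u_λ v}} = g λᵏ`. -/
structure IsMonomialBracket (k : ℤ) (g : R2 K ⊗[K] R2 K) (B : LambdaMap K (R2 K)) : Prop where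
  bracket : IsLambdaBracket (shift K) B
  skew : IsSkew (shift K) B
  uu : B (u K 0) (u K 0) = 0
  vv : B (v K 0) (v K 0) = 0
  uv : B (u K 0) (v K 0) = Finsupp.single k g

end FreeDifference

end DoubleMPVA

end

/-! In degree `λ⁰` a skewsymmetric `λ`-bracket is an ordinary `S`-equivariant double bracket, and
it can be recovered from that coefficient. On the free algebra the bracket prescribed by `g` pairs
each generator `x` with a single partner `τx`, so the Jacobi identity on `(x, x, τx)` becomes the
quadratic equation `(D ⊗ 1)(D τx) = (1 ⊗ D)(D τx)` for the double derivation `D = {{x, -}}`.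
Comparing leading terms shows that `D τx` involves only the letters `x` and `τx`, each at most once
in each tensor factor. The finitely many relations left between its coefficients make them a
symmetric matrix of rank at most one, that is, with `x = u_k` and `y = v`,
`g = a (r + t x + s y + q yx) ⊗ (r + t x + s y + q xy)`. Conversely all such squares satisfy the
Jacobi identity, and translations bring each of them to exactly one of the five normal forms. -/

noncomputable section

namespace DoubleMPVA

section Derivation

variable {K : Type*} [CommRing K] {X M : Type*} [AddCommGroup M] [Module K M]

theorem eq_zero_of_leibniz {L R : FreeAlgebra K X → M →ₗ[K] M} (hL : L 1 = LinearMap.id)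
    (hR : R 1 = LinearMap.id) {D : FreeAlgebra K X →ₗ[K] M}
    (hD : ∀ a b, D (a * b) = R b (D a) + L a (D b))
    (h : ∀ x, D (FreeAlgebra.ι K x) = 0) : D = 0 := by
  have map_one : D 1 = 0 := by simpa [hL, hR] using hD 1 1
  ext a
  induction a using FreeAlgebra.induction with
  | grade0 r => simp [Algebra.algebraMap_eq_smul_one, map_one]
  | grade1 x => exact h x
  | mul a b ha hb => simp [hD, ha, hb]
  | add a b ha hb => simp [ha, hb]

theorem eq_of_leibniz {L R : FreeAlgebra K X → M →ₗ[K] M} (hL : L 1 = LinearMap.id)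
    (hR : R 1 = LinearMap.id) {D E : FreeAlgebra K X →ₗ[K] M}
    (hD : ∀ a b, D (a * b) = R b (D a) + L a (D b))
    (hE : ∀ a b, E (a * b) = R b (E a) + L a (E b))
    (h : ∀ x, D (FreeAlgebra.ι K x) = E (FreeAlgebra.ι K x)) : D = E := by
  refine sub_eq_zero.1 (eq_zero_of_leibniz hL hR (fun a b => ?_) fun x => sub_eq_zero.2 (h x))
  simp only [LinearMap.sub_apply, hD, hE, map_sub]
  abel

/-- `D` is read off the algebra homomorphism `a ↦ a + D a` into the square-zero extension. -/
theorem exists_leibniz (L : FreeAlgebra K X →ₐ[K] Module.End K M)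
    (R : (FreeAlgebra K X)ᵐᵒᵖ →ₐ[K] Module.End K M)
    (hLR : ∀ a b m, L a (R b m) = R b (L a m)) (φ : X → M) :
    ∃ D : FreeAlgebra K X →ₗ[K] M, (∀ x, D (FreeAlgebra.ι K x) = φ x) ∧
      ∀ a b, D (a * b) = R (.op b) (D a) + L a (D b) := by
  let _ : Module (FreeAlgebra K X) M := Module.compHom M L.toRingHom
  let _ : Module (FreeAlgebra K X)ᵐᵒᵖ M := Module.compHom M R.toRingHom
  have : IsScalarTower K (FreeAlgebra K X) M := ⟨fun r a m => by
    change L (r • a) m = r • L a m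
    rw [map_smul, LinearMap.smul_apply]⟩
  have : IsScalarTower K (FreeAlgebra K X)ᵐᵒᵖ M := ⟨fun r a m => by
    change R (r • a) m = r • R a m
    rw [map_smul, LinearMap.smul_apply]⟩
  have : SMulCommClass (FreeAlgebra K X) (FreeAlgebra K X)ᵐᵒᵖ M := ⟨hLR⟩
  let graph : FreeAlgebra K X →ₐ[K] TrivSqZeroExt (FreeAlgebra K X) M :=
    FreeAlgebra.lift K fun x => .inl (FreeAlgebra.ι K x) + .inr (φ x)
  have fst_graph (a) : (graph a).fst = a := by
    have : (TrivSqZeroExt.fstHom K (FreeAlgebra K X) M).comp graph = AlgHom.id K _ := by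
      ext x; simp [graph]
    exact AlgHom.congr_fun this a
  refine ⟨(TrivSqZeroExt.sndHom (FreeAlgebra K X) M).restrictScalars K ∘ₗ graph.toLinearMap,
    fun x => by simp [graph], fun a b => ?_⟩
  change (graph (a * b)).snd = _
  rw [map_mul, TrivSqZeroExt.snd_mul, fst_graph, fst_graph, add_comm]
  rfl

end Derivation

section Actions

variable {K : Type*} [Field K] {V : Type*} [Ring V] [Algebra K V]

@[simp] theorem outerLeft_tmul (b x y : V) : outerLeft b (x ⊗ₜ[K] y) = (b * x) ⊗ₜ[K] y := rfl

@[simp] theorem outerRight_tmul (b x y : V) : outerRight b (x ⊗ₜ[K] y) = x ⊗ₜ[K] (y * b) := rfl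

@[simp] theorem innerLeft_tmul (b x y : V) : innerLeft b (x ⊗ₜ[K] y) = x ⊗ₜ[K] (b * y) := rfl

@[simp] theorem innerRight_tmul (b x y : V) : innerRight b (x ⊗ₜ[K] y) = (x * b) ⊗ₜ[K] y := rfl

@[simp] theorem flip_tmul (x y : V) : flip (x ⊗ₜ[K] y) = y ⊗ₜ[K] x := rfl

@[simp] theorem diag_tmul (S : V →ₐ[K] V) (x y : V) :
    diag S (x ⊗ₜ[K] y) = S x ⊗ₜ[K] S y := rfl

@[simp] theorem outerLeft_one : outerLeft (K := K) (1 : V) = LinearMap.id := by ext; simp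

@[simp] theorem outerRight_one : outerRight (K := K) (1 : V) = LinearMap.id := by ext; simp

theorem outerLeft_add (a b : V) :
    outerLeft (K := K) (a + b) = outerLeft a + outerLeft b := by
  ext; simp [add_mul, TensorProduct.add_tmul]

theorem outerRight_add (a b : V) :
    outerRight (K := K) (a + b) = outerRight a + outerRight b := by
  ext; simp [mul_add, TensorProduct.tmul_add]

theorem outerLeft_smul (r : K) (a : V) :
    outerLeft (K := K) (r • a) = r • outerLeft a := by
  ext; simp [TensorProduct.smul_tmul']

theorem outerRight_smul (r : K) (a : V) :
    outerRight (K := K) (r • a) = r • outerRight a := by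
  ext; simp

@[simp] theorem innerLeft_one : innerLeft (K := K) (1 : V) = LinearMap.id := by ext; simp

@[simp] theorem innerRight_one : innerRight (K := K) (1 : V) = LinearMap.id := by ext; simp

variable (a b : V) (t : V ⊗[K] V)

theorem outerLeft_outerRight : outerLeft a (outerRight b t) = outerRight b (outerLeft a t) := by
  induction t using TensorProduct.induction_on <;> simp_all

theorem innerLeft_innerRight : innerLeft a (innerRight b t) = innerRight b (innerLeft a t) := by
  induction t using TensorProduct.induction_on <;> simp_all

theorem outerRight_innerRight : outerRight a (innerRight b t) = innerRight b (outerRight a t) := by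
  induction t using TensorProduct.induction_on <;> simp_all

theorem outerRight_innerLeft : outerRight a (innerLeft b t) = innerLeft b (outerRight a t) := by
  induction t using TensorProduct.induction_on <;> simp_all [mul_assoc]

theorem outerLeft_innerRight : outerLeft a (innerRight b t) = innerRight b (outerLeft a t) := by
  induction t using TensorProduct.induction_on <;> simp_all [mul_assoc]

theorem outerLeft_innerLeft : outerLeft a (innerLeft b t) = innerLeft b (outerLeft a t) := by
  induction t using TensorProduct.induction_on <;> simp_all

theorem flip_outerLeft : flip (outerLeft b t) = innerLeft b (flip t) := by
  induction t using TensorProduct.induction_on <;> simp_all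

theorem flip_outerRight : flip (outerRight b t) = innerRight b (flip t) := by
  induction t using TensorProduct.induction_on <;> simp_all

theorem flip_innerLeft : flip (innerLeft b t) = outerLeft b (flip t) := by
  induction t using TensorProduct.induction_on <;> simp_all

theorem flip_innerRight : flip (innerRight b t) = outerRight b (flip t) := by
  induction t using TensorProduct.induction_on <;> simp_all

@[simp] theorem flip_flip : flip (flip t) = t := by
  induction t using TensorProduct.induction_on <;> simp_all

variable (S : V →ₐ[K] V)

theorem diag_flip : diag S (flip t) = flip (diag S t) := by
  induction t using TensorProduct.induction_on <;> simp_all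

theorem diag_outerLeft : diag S (outerLeft b t) = outerLeft (S b) (diag S t) := by
  induction t using TensorProduct.induction_on <;> simp_all

theorem diag_outerRight : diag S (outerRight b t) = outerRight (S b) (diag S t) := by
  induction t using TensorProduct.induction_on <;> simp_all

theorem diag_innerLeft : diag S (innerLeft b t) = innerLeft (S b) (diag S t) := by
  induction t using TensorProduct.induction_on <;> simp_all

theorem diag_innerRight : diag S (innerRight b t) = innerRight (S b) (diag S t) := by
  induction t using TensorProduct.induction_on <;> simp_all

end Actions

section DoubleBracket

variable {K : Type*} [Field K] {V : Type*} [Ring V] [Algebra K V]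

/-- Van den Bergh's double brackets on an associative algebra, without skewsymmetry. -/
structure IsDoubleBracket (P : V →ₗ[K] V →ₗ[K] V ⊗[K] V) : Prop where
  left : ∀ a b c, P a (b * c) = outerRight c (P a b) + outerLeft b (P a c)
  right : ∀ a b c, P (a * b) c = innerRight b (P a c) + innerLeft a (P b c)

variable {P : V →ₗ[K] V →ₗ[K] V ⊗[K] V}

theorem IsDoubleBracket.neg_flip (hP : IsDoubleBracket P) :
    IsDoubleBracket (-P.flip.compr₂ flip) where
  left a b c := by
    simp only [LinearMap.neg_apply, LinearMap.compr₂_apply, LinearMap.flip_apply, hP.right,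
      map_add, map_neg, flip_innerLeft, flip_innerRight]
    abel
  right a b c := by
    simp only [LinearMap.neg_apply, LinearMap.compr₂_apply, LinearMap.flip_apply, hP.left,
      map_add, map_neg, flip_outerLeft, flip_outerRight]
    abel

end DoubleBracket

section FreeDoubleBracket

variable {K : Type*} [Field K] {X : Type*}
  {P Q : FreeAlgebra K X →ₗ[K] FreeAlgebra K X →ₗ[K] FreeAlgebra K X ⊗[K] FreeAlgebra K X}

theorem IsDoubleBracket.ext_of_ι (hP : IsDoubleBracket P) (hQ : IsDoubleBracket Q)
    (h : ∀ x y, P (FreeAlgebra.ι K x) (FreeAlgebra.ι K y) =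
      Q (FreeAlgebra.ι K x) (FreeAlgebra.ι K y)) : P = Q := by
  have eq_on_ι (x) : P (FreeAlgebra.ι K x) = Q (FreeAlgebra.ι K x) :=
    eq_of_leibniz outerLeft_one outerRight_one (hP.left _) (hQ.left _) (h x)
  refine LinearMap.ext₂ fun a b => LinearMap.congr_fun (f := P.flip b) (g := Q.flip b) ?_ a
  refine eq_of_leibniz innerLeft_one innerRight_one (fun _ _ => hP.right _ _ b)
    (fun _ _ => hQ.right _ _ b) fun x => ?_
  simp only [LinearMap.flip_apply, eq_on_ι]

theorem IsDoubleBracket.skew_of_ι (hP : IsDoubleBracket P)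
    (h : ∀ x y, P (FreeAlgebra.ι K x) (FreeAlgebra.ι K y) =
      -flip (P (FreeAlgebra.ι K y) (FreeAlgebra.ι K x))) (a b : FreeAlgebra K X) :
    P a b = -flip (P b a) :=
  LinearMap.congr_fun₂ (hP.ext_of_ι hP.neg_flip h) a b

theorem IsDoubleBracket.equivariant_of_ι (hP : IsDoubleBracket P)
    (S : FreeAlgebra K X →ₐ[K] FreeAlgebra K X)
    (h : ∀ x y, P (S (FreeAlgebra.ι K x)) (S (FreeAlgebra.ι K y)) =
      diag S (P (FreeAlgebra.ι K x) (FreeAlgebra.ι K y))) (a b : FreeAlgebra K X) :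
    P (S a) (S b) = diag S (P a b) := by
  have eq_on_ι (x) : P (S (FreeAlgebra.ι K x)) ∘ₗ S.toLinearMap =
      diag S ∘ₗ P (FreeAlgebra.ι K x) := by
    refine eq_of_leibniz (L := fun b => outerLeft (S b)) (R := fun b => outerRight (S b))
      (by simp) (by simp) (fun a b => ?_) (fun a b => ?_) (h x)
    · simp [hP.left]
    · simp [hP.left, diag_outerLeft, diag_outerRight]
  refine LinearMap.congr_fun (f := P.flip (S b) ∘ₗ S.toLinearMap) (g := diag S ∘ₗ P.flip b) ?_ a
  refine eq_of_leibniz (L := fun a => innerLeft (S a)) (R := fun a => innerRight (S a))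
    (by simp) (by simp) (fun a b => ?_) (fun a b => ?_)
    fun x => LinearMap.congr_fun (eq_on_ι x) b
  · simp [hP.right]
  · simp [hP.right, diag_innerLeft, diag_innerRight]

theorem exists_outer_derivation (φ : X → FreeAlgebra K X ⊗[K] FreeAlgebra K X) :
    ∃ D : FreeAlgebra K X →ₗ[K] FreeAlgebra K X ⊗[K] FreeAlgebra K X,
      (∀ x, D (FreeAlgebra.ι K x) = φ x) ∧
        ∀ a b, D (a * b) = outerRight b (D a) + outerLeft a (D b) :=
  exists_leibniz ((Module.End.rTensorAlgHom K _ _).comp (Algebra.lmul K _))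
    ((Module.End.lTensorAlgHom K _ _).comp (Algebra.lsmul K K _))
    (fun a b t => outerLeft_outerRight a b.unop t) φ

theorem exists_isDoubleBracket (φ : X → X → FreeAlgebra K X ⊗[K] FreeAlgebra K X) :
    ∃ P : FreeAlgebra K X →ₗ[K] FreeAlgebra K X →ₗ[K] FreeAlgebra K X ⊗[K] FreeAlgebra K X,
      IsDoubleBracket P ∧ ∀ x y, P (FreeAlgebra.ι K x) (FreeAlgebra.ι K y) = φ x y := by
  choose D hDι hDmul using fun x => exists_outer_derivation (φ x)
  obtain ⟨P, hPι, hPmul⟩ := exists_leibniz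
    (M := FreeAlgebra K X →ₗ[K] FreeAlgebra K X ⊗[K] FreeAlgebra K X)
    ((Algebra.lsmul K K _).comp <|
      (Module.End.lTensorAlgHom K (FreeAlgebra K X) (FreeAlgebra K X)).comp <|
      Algebra.lmul K (FreeAlgebra K X))
    ((Algebra.lsmul K K _).comp <|
      (Module.End.rTensorAlgHom K (FreeAlgebra K X) (FreeAlgebra K X)).comp <|
      Algebra.lsmul K K (FreeAlgebra K X))
    (fun a b f => LinearMap.ext fun c => by
      exact innerLeft_innerRight a b.unop (f c)) D
  have hright (a b c) : P (a * b) c = innerRight b (P a c) + innerLeft a (P b c) :=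
    LinearMap.congr_fun (hPmul a b) c
  refine ⟨P, ⟨fun a b c => ?_, hright⟩, fun x y => by rw [hPι, hDι]⟩
  refine LinearMap.congr_fun (f := P.flip (b * c))
    (g := outerRight c ∘ₗ P.flip b + outerLeft b ∘ₗ P.flip c) ?_ a
  refine eq_of_leibniz innerLeft_one innerRight_one (fun _ _ => hright _ _ _) (fun x y => ?_)
    fun x => ?_
  · simp only [LinearMap.add_apply, LinearMap.comp_apply, LinearMap.flip_apply, hright, map_add,
      outerRight_innerRight, outerRight_innerLeft, outerLeft_innerRight, outerLeft_innerLeft]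
    abel
  · simp only [LinearMap.add_apply, LinearMap.comp_apply, LinearMap.flip_apply, hPι, hDmul]

end FreeDoubleBracket

section TripleTensor

variable {K : Type*} [Field K] {V : Type*} [Ring V] [Algebra K V]

/-- The outer left action `c (x ⊗ y ⊗ z) = c x ⊗ y ⊗ z`. -/
def outerLeft₃ (c : V) : V ⊗[K] (V ⊗[K] V) →ₗ[K] V ⊗[K] (V ⊗[K] V) :=
  (LinearMap.mulLeft K c).rTensor (V ⊗[K] V)

/-- The outer right action `(x ⊗ y ⊗ z) d = x ⊗ y ⊗ z d`. -/
def outerRight₃ (d : V) : V ⊗[K] (V ⊗[K] V) →ₗ[K] V ⊗[K] (V ⊗[K] V) :=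
  (outerRight d).lTensor V

/-- The product `(p ⊗ q)(x ⊗ y) = p ⊗ q x ⊗ y`. -/
def middleMul : V ⊗[K] V →ₗ[K] V ⊗[K] V →ₗ[K] V ⊗[K] (V ⊗[K] V) :=
  TensorProduct.curry <| ((LinearMap.mul' K V).rTensor V).lTensor V ∘ₗ
    (TensorProduct.assoc K V V V).symm.toLinearMap.lTensor V ∘ₗ
      (TensorProduct.assoc K V V (V ⊗[K] V)).toLinearMap

/-- The extension `x ⊗ y ↦ D x ⊗ y` of a map `D : V → V ⊗ V`, written `{{a_λ -}}_L` when
`D = {{a_λ -}}`. -/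
def leftExt (D : V →ₗ[K] V ⊗[K] V) : V ⊗[K] V →ₗ[K] V ⊗[K] (V ⊗[K] V) :=
  (TensorProduct.assoc K V V V).toLinearMap ∘ₗ D.rTensor V

/-- The extension `x ⊗ y ↦ x ⊗ D y` of a map `D : V → V ⊗ V`, written `{{a_λ -}}_R` when
`D = {{a_λ -}}`. -/
def rightExt (D : V →ₗ[K] V ⊗[K] V) : V ⊗[K] V →ₗ[K] V ⊗[K] (V ⊗[K] V) :=
  D.lTensor V

theorem leftExt_tmul (D : V →ₗ[K] V ⊗[K] V) (x y : V) :
    leftExt D (x ⊗ₜ y) = TensorProduct.assoc K V V V (D x ⊗ₜ y) := rfl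

theorem rightExt_tmul (D : V →ₗ[K] V ⊗[K] V) (x y : V) : rightExt D (x ⊗ₜ y) = x ⊗ₜ D y := rfl

theorem assoc_outerLeft_tmul (c : V) (t : V ⊗[K] V) (z : V) :
    TensorProduct.assoc K V V V (outerLeft c t ⊗ₜ z) =
      outerLeft₃ c (TensorProduct.assoc K V V V (t ⊗ₜ z)) := by
  induction t using TensorProduct.induction_on with
  | zero => simp
  | add s t hs ht => simp only [map_add, TensorProduct.add_tmul, hs, ht]
  | tmul x y => rfl

theorem assoc_outerRight_tmul (c : V) (t : V ⊗[K] V) (z : V) :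
    TensorProduct.assoc K V V V (outerRight c t ⊗ₜ z) = middleMul t (c ⊗ₜ z) := by
  induction t using TensorProduct.induction_on with
  | zero => simp
  | add s t hs ht =>
    simp only [map_add, TensorProduct.add_tmul, LinearMap.add_apply, hs, ht]
  | tmul x y => rfl

theorem assoc_tmul_mul (t : V ⊗[K] V) (z d : V) :
    TensorProduct.assoc K V V V (t ⊗ₜ (z * d)) =
      outerRight₃ d (TensorProduct.assoc K V V V (t ⊗ₜ z)) := by
  induction t using TensorProduct.induction_on with
  | zero => simp
  | add s t hs ht => simp only [map_add, TensorProduct.add_tmul, hs, ht]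
  | tmul x y => rfl

theorem tmul_outerLeft (x c : V) (t : V ⊗[K] V) : x ⊗ₜ outerLeft c t = middleMul (x ⊗ₜ c) t := by
  induction t using TensorProduct.induction_on with
  | zero => simp
  | add s t hs ht => simp only [map_add, TensorProduct.tmul_add, hs, ht]
  | tmul y z => rfl

theorem insertMiddle_outerLeft_tmul (c : V) (t : V ⊗[K] V) (z : V) :
    insertMiddle (outerLeft c t ⊗ₜ z) = outerLeft₃ c (insertMiddle (t ⊗ₜ z)) := by
  induction t using TensorProduct.induction_on with
  | zero => simp
  | add s t hs ht => simp only [map_add, TensorProduct.add_tmul, hs, ht]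
  | tmul x y => rfl

theorem insertMiddle_outerRight_tmul (d : V) (t : V ⊗[K] V) (z : V) :
    insertMiddle (outerRight d t ⊗ₜ z) = outerRight₃ d (insertMiddle (t ⊗ₜ z)) := by
  induction t using TensorProduct.induction_on with
  | zero => simp
  | add s t hs ht => simp only [map_add, TensorProduct.add_tmul, hs, ht]
  | tmul x y => rfl

variable {D : V →ₗ[K] V ⊗[K] V}

theorem leftExt_outerRight (d : V) (t : V ⊗[K] V) :
    leftExt D (outerRight d t) = outerRight₃ d (leftExt D t) := by
  induction t using TensorProduct.induction_on with
  | zero => simp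
  | add s t hs ht => simp only [map_add, hs, ht]
  | tmul x y => rw [outerRight_tmul, leftExt_tmul, leftExt_tmul, assoc_tmul_mul]

theorem rightExt_outerLeft (c : V) (t : V ⊗[K] V) :
    rightExt D (outerLeft c t) = outerLeft₃ c (rightExt D t) := by
  induction t using TensorProduct.induction_on with
  | zero => simp
  | add s t hs ht => simp only [map_add, hs, ht]
  | tmul x y => rfl

theorem leftExt_outerLeft (hD : ∀ a b, D (a * b) = outerRight b (D a) + outerLeft a (D b))
    (c : V) (t : V ⊗[K] V) :
    leftExt D (outerLeft c t) = outerLeft₃ c (leftExt D t) + middleMul (D c) t := by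
  induction t using TensorProduct.induction_on with
  | zero => simp
  | add s t hs ht => simp only [map_add, hs, ht]; abel
  | tmul x y =>
    rw [outerLeft_tmul, leftExt_tmul, leftExt_tmul, hD, TensorProduct.add_tmul, map_add,
      assoc_outerLeft_tmul, assoc_outerRight_tmul, add_comm]

theorem rightExt_outerRight (hD : ∀ a b, D (a * b) = outerRight b (D a) + outerLeft a (D b))
    (d : V) (t : V ⊗[K] V) :
    rightExt D (outerRight d t) = outerRight₃ d (rightExt D t) + middleMul t (D d) := by
  induction t using TensorProduct.induction_on with
  | zero => simp
  | add s t hs ht => simp only [map_add, LinearMap.add_apply, hs, ht]; abel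
  | tmul x y =>
    rw [outerRight_tmul, rightExt_tmul, rightExt_tmul, hD, TensorProduct.tmul_add,
      tmul_outerLeft]
    rfl

end TripleTensor

section Jacobiator

variable {K : Type*} [Field K] {V : Type*} [Ring V] [Algebra K V]

/-- The failure `{{a, {{b, c}}}}_L - {{b, {{a, c}}}}_R - {{{{a, b}}, c}}_L` of the Jacobi
identity for a double bracket, as a linear map in `c`. -/
def jacobiator (P : V →ₗ[K] V →ₗ[K] V ⊗[K] V) (a b : V) : V →ₗ[K] V ⊗[K] (V ⊗[K] V) :=
  leftExt (P a) ∘ₗ P b - rightExt (P b) ∘ₗ P a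
    - insertMiddle ∘ₗ LinearMap.applyₗ (P a b) ∘ₗ LinearMap.rTensorHom V ∘ₗ P.flip

variable {P : V →ₗ[K] V →ₗ[K] V ⊗[K] V}

theorem jacobiator_apply (a b c : V) :
    jacobiator P a b c = leftExt (P a) (P b c) - rightExt (P b) (P a c)
      - insertMiddle ((P.flip c).rTensor V (P a b)) := rfl

theorem jacobiator_of_apply_eq_zero {a b : V} (hab : P a b = 0) (c : V) :
    jacobiator P a b c = leftExt (P a) (P b c) - rightExt (P b) (P a c) := by
  rw [jacobiator_apply, hab, map_zero, map_zero, sub_zero]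

theorem jacobiator_leibniz (hP : IsDoubleBracket P) (a b c d : V) :
    jacobiator P a b (c * d) =
      outerRight₃ d (jacobiator P a b c) + outerLeft₃ c (jacobiator P a b d) := by
  have inner_leibniz (t : V ⊗[K] V) :
      insertMiddle ((P.flip (c * d)).rTensor V t) =
        outerRight₃ d (insertMiddle ((P.flip c).rTensor V t))
          + outerLeft₃ c (insertMiddle ((P.flip d).rTensor V t)) := by
    induction t using TensorProduct.induction_on with
    | zero => simp
    | add s t hs ht => simp only [map_add, hs, ht]; abel
    | tmul x y =>
      simp only [LinearMap.rTensor_tmul, LinearMap.flip_apply, hP.left, TensorProduct.add_tmul,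
        map_add, insertMiddle_outerLeft_tmul, insertMiddle_outerRight_tmul]
  simp only [jacobiator_apply, hP.left, map_add, map_sub, leftExt_outerRight,
    leftExt_outerLeft (hP.left a), rightExt_outerLeft, rightExt_outerRight (hP.left b),
    inner_leibniz]
  abel

/-- The cyclic permutation `x ⊗ y ⊗ z ↦ y ⊗ z ⊗ x`. -/
def rot : V ⊗[K] (V ⊗[K] V) →ₗ[K] V ⊗[K] (V ⊗[K] V) :=
  (TensorProduct.assoc K V V V).toLinearMap ∘ₗ (TensorProduct.comm K V (V ⊗[K] V)).toLinearMap

theorem rot_tmul (x y z : V) : rot (x ⊗ₜ[K] (y ⊗ₜ[K] z)) = y ⊗ₜ[K] (z ⊗ₜ[K] x) := rfl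

theorem rot_rot_rot (t : V ⊗[K] (V ⊗[K] V)) : rot (rot (rot t)) = t := by
  have : rot ∘ₗ rot ∘ₗ rot = (LinearMap.id : V ⊗[K] (V ⊗[K] V) →ₗ[K] _) := by
    ext; simp [rot_tmul]
  exact LinearMap.congr_fun this t

theorem rightExt_flip (D : V →ₗ[K] V ⊗[K] V) (t : V ⊗[K] V) :
    rightExt D (flip t) = rot (rot (leftExt D t)) := by
  induction t using TensorProduct.induction_on with
  | zero => simp
  | add s t hs ht => simp only [map_add, hs, ht]
  | tmul x y =>
    rw [flip_tmul, rightExt_tmul, leftExt_tmul]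
    induction D x using TensorProduct.induction_on with
    | zero => simp
    | add s t hs ht => simp only [map_add, TensorProduct.add_tmul, TensorProduct.tmul_add, hs, ht]
    | tmul p q => rfl

theorem insertMiddle_flip_tmul (t : V ⊗[K] V) (z : V) :
    insertMiddle (flip t ⊗ₜ z) = rot (TensorProduct.assoc K V V V (t ⊗ₜ z)) := by
  induction t using TensorProduct.induction_on with
  | zero => simp
  | add s t hs ht => simp only [map_add, TensorProduct.add_tmul, hs, ht]
  | tmul x y => rfl

theorem jacobiator_eq_sum_rot (hskew : ∀ a b, P a b = -flip (P b a)) (a b c : V) :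
    jacobiator P a b c = leftExt (P a) (P b c) + rot (rot (leftExt (P b) (P c a)))
      + rot (leftExt (P c) (P a b)) := by
  have inner (t : V ⊗[K] V) :
      insertMiddle ((P.flip c).rTensor V t) = -rot (leftExt (P c) t) := by
    induction t using TensorProduct.induction_on with
    | zero => simp
    | add s t hs ht => simp only [map_add, hs, ht, neg_add]
    | tmul x y =>
      rw [LinearMap.rTensor_tmul, LinearMap.flip_apply, hskew x c, TensorProduct.neg_tmul,
        map_neg, insertMiddle_flip_tmul, leftExt_tmul]
  rw [jacobiator_apply, inner, hskew a c, map_neg, rightExt_flip]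
  abel

theorem jacobiator_cyclic (hskew : ∀ a b, P a b = -flip (P b a)) (a b c : V) :
    jacobiator P a b c = rot (rot (jacobiator P b c a)) := by
  rw [jacobiator_eq_sum_rot hskew, jacobiator_eq_sum_rot hskew b c a]
  simp only [map_add, rot_rot_rot]
  abel

theorem jacobiator_eq_zero_of_ι {X : Type*}
    {P : FreeAlgebra K X →ₗ[K] FreeAlgebra K X →ₗ[K] FreeAlgebra K X ⊗[K] FreeAlgebra K X}
    (hP : IsDoubleBracket P) (hskew : ∀ a b, P a b = -flip (P b a))
    (h : ∀ x y z, jacobiator P (FreeAlgebra.ι K x) (FreeAlgebra.ι K y) (FreeAlgebra.ι K z) = 0)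
    (a b c : FreeAlgebra K X) : jacobiator P a b c = 0 := by
  have ext_last {a b} (h : ∀ z, jacobiator P a b (FreeAlgebra.ι K z) = 0) (c) :
      jacobiator P a b c = 0 := by
    rw [eq_zero_of_leibniz (L := outerLeft₃) (R := outerRight₃) (by ext; simp [outerLeft₃])
      (by simp [outerRight₃]) (jacobiator_leibniz hP a b) h, LinearMap.zero_apply]
  have rotate {a b c} (h : jacobiator P c a b = 0) : jacobiator P a b c = 0 := by
    rw [jacobiator_cyclic hskew, jacobiator_cyclic hskew b, h]
    simp only [map_zero]
  have eq_zero_ι_ι (x y) := ext_last (h x y)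
  have eq_zero_ι (x b) := ext_last fun z => rotate (eq_zero_ι_ι z x b)
  exact ext_last (fun z => rotate (eq_zero_ι z a b)) c

end Jacobiator

section LambdaBracket

variable {K : Type*} [Field K] {V : Type*} [Ring V] [Algebra K V] {S : V ≃ₐ[K] V}

@[simp] theorem diagPow_tmul (S : V ≃ₐ[K] V) (n : ℤ) (x y : V) :
    diagPow S n (x ⊗ₜ[K] y) = (S ^ n) x ⊗ₜ[K] (S ^ n) y := rfl

@[simp] theorem diagPow_zero (S : V ≃ₐ[K] V) (t : V ⊗[K] V) : diagPow S 0 t = t := by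
  induction t using TensorProduct.induction_on <;> simp_all

theorem diagPow_diagPow (S : V ≃ₐ[K] V) (m n : ℤ) (t : V ⊗[K] V) :
    diagPow S m (diagPow S n t) = diagPow S (m + n) t := by
  induction t using TensorProduct.induction_on <;> simp_all [zpow_add]

theorem diagPow_flip (S : V ≃ₐ[K] V) (n : ℤ) (t : V ⊗[K] V) :
    diagPow S n (flip t) = flip (diagPow S n t) :=
  diag_flip t _

section Coefficients

variable {B : LambdaMap K V}

theorem IsLambdaBracket.isDoubleBracket (h : IsLambdaBracket S B) : IsDoubleBracket (B.coeff 0) :=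
  ⟨fun a b c => h.leibniz_left a b c 0, fun a b c => h.leibniz_right a b c 0⟩

theorem IsLambdaBracket.coeff_eq (h : IsLambdaBracket S B) (n : ℤ) (a : V) :
    B.coeff n a = B.coeff 0 ((S ^ n) a) := by
  have coeff_succ (n a) : B.coeff (n + 1) a = B.coeff n (S a) :=
    LinearMap.ext fun b => (h.sesq_left a b n).symm
  induction n using Int.induction_on generalizing a with
  | zero => simp
  | succ n ih => rw [coeff_succ, ih, ← AlgEquiv.mul_apply, ← zpow_add_one]
  | pred n ih =>
    obtain ⟨a, rfl⟩ := S.surjective a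
    rw [← coeff_succ, sub_add_cancel, ih, ← AlgEquiv.mul_apply, ← zpow_add_one, sub_add_cancel]

theorem equivariant_zpow {P : V →ₗ[K] V →ₗ[K] V ⊗[K] V}
    (hS : ∀ a b, P (S a) (S b) = diagPow S 1 (P a b)) (n : ℤ) (a b : V) :
    P ((S ^ n) a) ((S ^ n) b) = diagPow S n (P a b) := by
  induction n using Int.induction_on generalizing a b with
  | zero => simp
  | succ n ih =>
    rw [zpow_add_one, AlgEquiv.mul_apply, AlgEquiv.mul_apply, ih, hS, diagPow_diagPow]
  | pred n ih =>
    obtain ⟨a, rfl⟩ := S.surjective a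
    obtain ⟨b, rfl⟩ := S.surjective b
    rw [← AlgEquiv.mul_apply, ← AlgEquiv.mul_apply, ← zpow_add_one, sub_add_cancel, ih, hS,
      diagPow_diagPow, sub_add_cancel]

theorem IsLambdaBracket.coeff_zero_equivariant (h : IsLambdaBracket S B) (n : ℤ) (a b : V) :
    B.coeff 0 ((S ^ n) a) ((S ^ n) b) = diagPow S n (B.coeff 0 a b) :=
  equivariant_zpow (fun a b => by rw [h.sesq_right, h.sesq_left, zero_sub, neg_add_cancel]) n a b

theorem IsSkew.coeff_zero (h : IsSkew S B) (a b : V) :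
    B.coeff 0 a b = -flip (B.coeff 0 b a) := by
  simpa using h a b 0

theorem IsLambdaBracket.brArgL_eq (h : IsLambdaBracket S B) (n : ℤ) (c : V) (t : V ⊗[K] V) :
    brArgL S B n c t = insertMiddle (((B.coeff 0).flip c).rTensor V (diagPow S n t)) := by
  induction t using TensorProduct.induction_on with
  | zero => simp
  | add s t hs ht => simp only [map_add, hs, ht]
  | tmul x y => simp [brArgL, h.coeff_eq n x]

theorem IsLambdaBracket.isJacobi_iff (h : IsLambdaBracket S B) :
    IsJacobi S B ↔ ∀ a b c, jacobiator (B.coeff 0) a b c = 0 := by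
  have coeff_jacobi (a b c m n) : brL B m a (B.coeff n b c) - brR B n b (B.coeff m a c)
      - brArgL S B n c (B.coeff (m - n) a b) =
      jacobiator (B.coeff 0) ((S ^ m) a) ((S ^ n) b) c := by
    rw [jacobiator_apply, h.brArgL_eq, h.coeff_eq (m - n), ← h.coeff_zero_equivariant,
      ← AlgEquiv.mul_apply, ← zpow_add, add_sub_cancel, brL, brR, h.coeff_eq n b, h.coeff_eq m a]
    rfl
  refine ⟨fun hJ a b c => ?_, fun hJ a b c m n => by rw [coeff_jacobi, hJ]⟩
  simpa using (coeff_jacobi a b c 0 0).symm.trans (hJ a b c 0 0)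

end Coefficients

/-- The `λ`-map with coefficients `P (Sⁿ a) b`, the only one compatible with
sesquilinearity whose coefficient of `λ⁰` is `P`. -/
def lambdaOfBracket (S : V ≃ₐ[K] V) (P : V →ₗ[K] V →ₗ[K] V ⊗[K] V)
    (hfin : ∀ a b, (Function.support fun n : ℤ => P ((S ^ n) a) b).Finite) : LambdaMap K V :=
  LinearMap.mk₂ K (fun a b => Finsupp.ofSupportFinite _ (hfin a b))
    (fun _ _ _ => by ext; simp [Finsupp.ofSupportFinite_coe])
    (fun _ _ _ => by ext; simp [Finsupp.ofSupportFinite_coe])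
    (fun _ _ _ => by ext; simp [Finsupp.ofSupportFinite_coe])
    (fun _ _ _ => by ext; simp [Finsupp.ofSupportFinite_coe])

variable {P : V →ₗ[K] V →ₗ[K] V ⊗[K] V}
  {hfin : ∀ a b, (Function.support fun n : ℤ => P ((S ^ n) a) b).Finite}

theorem coeff_lambdaOfBracket (n : ℤ) (a b : V) :
    (lambdaOfBracket S P hfin).coeff n a b = P ((S ^ n) a) b := rfl

theorem isLambdaBracket_lambdaOfBracket (hP : IsDoubleBracket P)
    (hS : ∀ a b, P (S a) (S b) = diagPow S 1 (P a b)) :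
    IsLambdaBracket S (lambdaOfBracket S P hfin) where
  sesq_left a b n := by
    rw [coeff_lambdaOfBracket, coeff_lambdaOfBracket, zpow_add_one, AlgEquiv.mul_apply]
  sesq_right a b n := by
    rw [coeff_lambdaOfBracket, coeff_lambdaOfBracket, ← hS, ← AlgEquiv.mul_apply,
      ← zpow_one_add, add_sub_cancel]
  leibniz_left a b c n := by simp only [coeff_lambdaOfBracket, hP.left]
  leibniz_right a b c n := by simp only [coeff_lambdaOfBracket, map_mul, hP.right]

theorem isSkew_lambdaOfBracket (hS : ∀ a b, P (S a) (S b) = diagPow S 1 (P a b))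
    (hskew : ∀ a b, P a b = -flip (P b a)) : IsSkew S (lambdaOfBracket S P hfin) := fun a b n => by
  rw [coeff_lambdaOfBracket, coeff_lambdaOfBracket, diagPow_flip, ← equivariant_zpow hS, hskew,
    ← AlgEquiv.mul_apply, ← zpow_add, add_neg_cancel, zpow_zero, AlgEquiv.one_apply]

end LambdaBracket

section Words

variable {K : Type*} [Field K] {X : Type*}

/-- The monomial of a free algebra given by a word. -/
def word (K : Type*) [Field K] {X : Type*} (l : List X) : FreeAlgebra K X :=
  (l.map (FreeAlgebra.ι K)).prod

@[simp] theorem word_nil : word K ([] : List X) = 1 := rfl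

theorem word_cons (x : X) (l : List X) : word K (x :: l) = FreeAlgebra.ι K x * word K l := by
  simp [word]

theorem word_append (l m : List X) : word K (l ++ m) = word K l * word K m := by
  simp [word]

theorem equivMonoidAlgebraFreeMonoid_word (l : List X) :
    FreeAlgebra.equivMonoidAlgebraFreeMonoid (R := K) (word K l) =
      MonoidAlgebra.of K (FreeMonoid X) (FreeMonoid.ofList l) := by
  induction l with
  | nil => rw [word_nil, map_one]; rfl
  | cons x l ih =>
    rw [word_cons, map_mul, ih, FreeMonoid.ofList_cons, map_mul]
    congr 1
    simp [FreeAlgebra.equivMonoidAlgebraFreeMonoid]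

/-- The basis of a free algebra consisting of words. -/
def wordBasis (K : Type*) [Field K] (X : Type*) : Module.Basis (List X) K (FreeAlgebra K X) :=
  (FreeAlgebra.basisFreeMonoid K X).reindex FreeMonoid.toList

theorem wordBasis_apply (l : List X) : wordBasis K X l = word K l := by
  rw [wordBasis, Module.Basis.reindex_apply, FreeAlgebra.basisFreeMonoid, Module.Basis.map_apply]
  refine (LinearEquiv.symm_apply_eq _).2 ?_
  simp only [LinearEquiv.trans_apply]
  change _ = MonoidAlgebra.coeffLinearEquiv _
    (FreeAlgebra.equivMonoidAlgebraFreeMonoid (R := K) (word K l))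
  rw [equivMonoidAlgebraFreeMonoid_word]
  simp

theorem ext_of_word {M : Type*} [AddCommGroup M] [Module K M] {f g : FreeAlgebra K X →ₗ[K] M}
    (h : ∀ l, f (word K l) = g (word K l)) : f = g :=
  (wordBasis K X).ext fun l => by rw [wordBasis_apply, h]

/-- The coefficient of a word in an element of a free algebra. -/
def wcoef (A : List X) : FreeAlgebra K X →ₗ[K] K := (wordBasis K X).coord A

/-- The coefficient of `A ⊗ B`, for words `A` and `B`. -/
def wcoef₂ (A B : List X) : FreeAlgebra K X ⊗[K] FreeAlgebra K X →ₗ[K] K :=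
  LinearMap.mul' K K ∘ₗ TensorProduct.map (wcoef A) (wcoef B)

/-- The coefficient of `A ⊗ B ⊗ C`, for words `A`, `B` and `C`. -/
def wcoef₃ (A B C : List X) :
    FreeAlgebra K X ⊗[K] (FreeAlgebra K X ⊗[K] FreeAlgebra K X) →ₗ[K] K :=
  LinearMap.mul' K K ∘ₗ TensorProduct.map (wcoef A) (wcoef₂ B C)

theorem wcoef₂_tmul (A B : List X) (a b : FreeAlgebra K X) :
    wcoef₂ A B (a ⊗ₜ[K] b) = wcoef A a * wcoef B b := rfl

theorem wcoef₃_tmul (A B C : List X) (a : FreeAlgebra K X)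
    (t : FreeAlgebra K X ⊗[K] FreeAlgebra K X) :
    wcoef₃ A B C (a ⊗ₜ[K] t) = wcoef A a * wcoef₂ B C t := rfl

theorem wcoef₃_assoc_tmul (A B C : List X) (t : FreeAlgebra K X ⊗[K] FreeAlgebra K X)
    (c : FreeAlgebra K X) :
    wcoef₃ A B C (TensorProduct.assoc K _ _ _ (t ⊗ₜ[K] c)) = wcoef₂ A B t * wcoef C c := by
  induction t using TensorProduct.induction_on with
  | zero => simp
  | add s t hs ht => simp only [map_add, TensorProduct.add_tmul, hs, ht, add_mul]
  | tmul a b =>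
    rw [TensorProduct.assoc_tmul, wcoef₃_tmul, wcoef₂_tmul, wcoef₂_tmul, mul_assoc]

theorem wcoef₂_flip (A B : List X) (t : FreeAlgebra K X ⊗[K] FreeAlgebra K X) :
    wcoef₂ A B (flip t) = wcoef₂ B A t := by
  induction t using TensorProduct.induction_on with
  | zero => simp
  | add x y hx hy => simp only [map_add, hx, hy]
  | tmul x y => rw [flip_tmul, wcoef₂_tmul, wcoef₂_tmul, mul_comm]

theorem wcoef₂_eq_repr (A B : List X) (t : FreeAlgebra K X ⊗[K] FreeAlgebra K X) :
    wcoef₂ A B t = ((wordBasis K X).tensorProduct (wordBasis K X)).repr t (A, B) := by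
  induction t using TensorProduct.induction_on with
  | zero => simp
  | add x y hx hy => simp only [map_add, hx, hy, Finsupp.add_apply]
  | tmul x y =>
    rw [wcoef₂_tmul, Module.Basis.tensorProduct_repr_tmul_apply, smul_eq_mul, mul_comm]; rfl

theorem ext_wcoef₂ {s t : FreeAlgebra K X ⊗[K] FreeAlgebra K X}
    (h : ∀ A B, wcoef₂ A B s = wcoef₂ A B t) : s = t := by
  refine ((wordBasis K X).tensorProduct (wordBasis K X)).ext_elem fun ⟨A, B⟩ => ?_
  rw [← wcoef₂_eq_repr, ← wcoef₂_eq_repr, h]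

theorem exists_wcoef₂_ne_zero {t : FreeAlgebra K X ⊗[K] FreeAlgebra K X} (ht : t ≠ 0) :
    ∃ A B, wcoef₂ A B t ≠ 0 := by
  contrapose! ht
  exact ext_wcoef₂ fun A B => by rw [ht, map_zero]

theorem finite_support_wcoef₂ (t : FreeAlgebra K X ⊗[K] FreeAlgebra K X) :
    {p : List X × List X | wcoef₂ p.1 p.2 t ≠ 0}.Finite := by
  simp only [wcoef₂_eq_repr]
  exact Finsupp.hasFiniteSupport _

theorem wcoef_word [DecidableEq X] (A B : List X) :
    wcoef A (word K B) = if B = A then 1 else 0 := by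
  rw [wcoef, ← wordBasis_apply, Module.Basis.coord_apply, Module.Basis.repr_self,
    Finsupp.single_apply]

theorem wcoef_cons_ι_mul [DecidableEq X] (x y : X) (A : List X) (a : FreeAlgebra K X) :
    wcoef (x :: A) (FreeAlgebra.ι K y * a) = if y = x then wcoef A a else 0 := by
  have on_words : wcoef (x :: A) ∘ₗ LinearMap.mulLeft K (FreeAlgebra.ι K y) =
      (if y = x then (1 : K) else 0) • wcoef A := by
    refine ext_of_word fun l => ?_
    simp only [LinearMap.comp_apply, LinearMap.mulLeft_apply, ← word_cons, wcoef_word,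
      LinearMap.smul_apply]
    by_cases h : y = x <;> simp [h]
  simpa only [LinearMap.comp_apply, LinearMap.mulLeft_apply, LinearMap.smul_apply, smul_eq_mul,
    ite_mul, one_mul, zero_mul] using LinearMap.congr_fun on_words a

theorem wcoef_nil_ι_mul (y : X) (a : FreeAlgebra K X) :
    wcoef [] (FreeAlgebra.ι K y * a) = 0 := by
  classical
  have on_words : wcoef [] ∘ₗ LinearMap.mulLeft K (FreeAlgebra.ι K y) = 0 :=
    ext_of_word fun l => by simp [← word_cons, wcoef_word]
  exact LinearMap.congr_fun on_words a

theorem wcoef_word_mul_word [DecidableEq X] (B l m : List X) :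
    wcoef B (word K m * word K l) = ∑ j ∈ Finset.range (B.length + 1),
      if B.drop j = l then wcoef (B.take j) (word K m) else 0 := by
  simp only [← word_append, wcoef_word]
  split_ifs with h
  · subst h
    rw [Finset.sum_eq_single m.length]
    · simp
    · intro j hj hne
      split_ifs with _ h
      · rw [h] at hne
        simp only [List.length_append, Finset.mem_range] at hj
        simp only [List.length_take, List.length_append] at hne
        omega
      all_goals rfl
    · simp
  · refine (Finset.sum_eq_zero fun j _ => ?_).symm
    split_ifs with hl hm
    · exact absurd (by rw [← hl, hm, List.take_append_drop]) h
    all_goals rfl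

theorem wcoef_mul_word [DecidableEq X] (B l : List X) (a : FreeAlgebra K X) :
    wcoef B (a * word K l) =
      ∑ j ∈ Finset.range (B.length + 1), if B.drop j = l then wcoef (B.take j) a else 0 := by
  have on_words : wcoef B ∘ₗ LinearMap.mulRight K (word K l) =
      ∑ j ∈ Finset.range (B.length + 1), (if B.drop j = l then (1 : K) else 0) •
        wcoef (B.take j) := by
    refine ext_of_word fun m => ?_
    simp only [LinearMap.comp_apply, LinearMap.mulRight_apply, wcoef_word_mul_word,
      LinearMap.sum_apply, LinearMap.smul_apply, smul_eq_mul, ite_mul, one_mul, zero_mul]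
  simpa only [LinearMap.comp_apply, LinearMap.mulRight_apply, LinearMap.sum_apply,
    LinearMap.smul_apply, smul_eq_mul, ite_mul, one_mul, zero_mul] using
    LinearMap.congr_fun on_words a

theorem wcoef₂_outerRight_word [DecidableEq X] (A B l : List X)
    (t : FreeAlgebra K X ⊗[K] FreeAlgebra K X) :
    wcoef₂ A B (outerRight (word K l) t) = ∑ j ∈ Finset.range (B.length + 1),
      if B.drop j = l then wcoef₂ A (B.take j) t else 0 := by
  induction t using TensorProduct.induction_on with
  | zero => simp
  | add s t hs ht =>
    simp only [map_add, hs, ht, ← Finset.sum_add_distrib]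
    refine Finset.sum_congr rfl fun j _ => ?_
    split_ifs <;> simp
  | tmul a b =>
    simp only [outerRight_tmul, wcoef₂_tmul, wcoef_mul_word, Finset.mul_sum, mul_ite, mul_zero]

theorem wcoef₂_cons_outerLeft_ι [DecidableEq X] (x z : X) (A B : List X)
    (t : FreeAlgebra K X ⊗[K] FreeAlgebra K X) :
    wcoef₂ (x :: A) B (outerLeft (FreeAlgebra.ι K z) t) =
      if z = x then wcoef₂ A B t else 0 := by
  induction t using TensorProduct.induction_on with
  | zero => simp
  | add s t hs ht => split_ifs at hs ht ⊢ <;> simp only [map_add, hs, ht, add_zero]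
  | tmul a b => simp only [outerLeft_tmul, wcoef₂_tmul, wcoef_cons_ι_mul, ite_mul, zero_mul]

theorem wcoef₂_nil_outerLeft_ι (z : X) (B : List X) (t : FreeAlgebra K X ⊗[K] FreeAlgebra K X) :
    wcoef₂ [] B (outerLeft (FreeAlgebra.ι K z) t) = 0 := by
  induction t using TensorProduct.induction_on with
  | zero => simp
  | add s t hs ht => simp only [map_add, hs, ht, add_zero]
  | tmul a b => simp only [outerLeft_tmul, wcoef₂_tmul, wcoef_nil_ι_mul, zero_mul]

end Words

section SplitSum

variable {K : Type*} [Field K] {X : Type*}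

/-- The coefficient of `A ⊗ B` in the product of `∑ f w₁ w₂ w₁ ⊗ w₂` and `∑ γ α β α ⊗ β` for
the multiplication `(w₁ ⊗ w₂) (α ⊗ β) = w₁ α ⊗ β w₂`. -/
def splitSum (f γ : List X → List X → K) (A B : List X) : K :=
  ∑ i ∈ Finset.range (A.length + 1), ∑ j ∈ Finset.range (B.length + 1),
    f (A.take i) (B.drop j) * γ (A.drop i) (B.take j)

theorem splitSum_nil (f γ : List X → List X → K) (B : List X) :
    splitSum f γ [] B = ∑ j ∈ Finset.range (B.length + 1),
      f [] (B.drop j) * γ [] (B.take j) := by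
  simp [splitSum]

theorem splitSum_cons (f γ : List X → List X → K) (x : X) (A B : List X) :
    splitSum f γ (x :: A) B =
      (∑ j ∈ Finset.range (B.length + 1), f [] (B.drop j) * γ (x :: A) (B.take j)) +
        splitSum (fun w => f (x :: w)) γ A B := by
  simp only [splitSum, List.length_cons]
  rw [Finset.sum_range_succ', add_comm]
  rfl

theorem splitSum_zero_left (γ : List X → List X → K) (A B : List X) :
    splitSum (fun _ _ => 0) γ A B = 0 := by
  simp [splitSum]

theorem splitSum_of_left_nil {f : List X → List X → K}
    (hf : ∀ w₁ w₂, w₁ ≠ [] → f w₁ w₂ = 0) (γ : List X → List X → K) (A B : List X) :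
    splitSum f γ A B = ∑ j ∈ Finset.range (B.length + 1), f [] (B.drop j) * γ A (B.take j) := by
  cases A with
  | nil => exact splitSum_nil f γ B
  | cons x A =>
    have tail_eq_zero : (fun w => f (x :: w)) = fun _ _ => 0 :=
      funext₂ fun _ _ => hf _ _ (by simp)
    rw [splitSum_cons, tail_eq_zero, splitSum_zero_left, add_zero]

theorem sum_take_drop_of_nil {f : List X → K} (hf : ∀ w, w ≠ [] → f w = 0) (γ : List X → K)
    (B : List X) : ∑ j ∈ Finset.range (B.length + 1), f (B.drop j) * γ (B.take j) =
      f [] * γ B := by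
  rw [Finset.sum_eq_single B.length]
  · simp
  · intro j hj hne
    rw [hf _ (by simp only [Finset.mem_range, ne_eq, List.drop_eq_nil_iff] at hj ⊢; omega),
      zero_mul]
  · simp

theorem splitSum_of_right_nil {f : List X → List X → K}
    (hf : ∀ w₁ w₂, w₂ ≠ [] → f w₁ w₂ = 0) (γ : List X → List X → K) (A B : List X) :
    splitSum f γ A B = ∑ i ∈ Finset.range (A.length + 1), f (A.take i) [] * γ (A.drop i) B :=
  Finset.sum_congr rfl fun _ _ => sum_take_drop_of_nil (hf _) _ B

theorem exists_ne_zero_of_splitSum_ne_zero {f γ : List X → List X → K} {A B : List X}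
    (h : splitSum f γ A B ≠ 0) : ∃ w₁ w₂, f w₁ w₂ ≠ 0 := by
  contrapose! h
  simp [splitSum, h]

end SplitSum

section DerivationCoefficients

variable {K : Type*} [Field K] {X : Type*}
  {D : FreeAlgebra K X →ₗ[K] FreeAlgebra K X ⊗[K] FreeAlgebra K X} {y : X}

theorem wcoef₂_outerRight_derivation_ι
    (hy : ∀ x, x ≠ y → D (FreeAlgebra.ι K x) = 0) (z : X) (l A B : List X) :
    wcoef₂ A B (outerRight (word K l) (D (FreeAlgebra.ι K z))) =
      ∑ j ∈ Finset.range (B.length + 1), wcoef (y :: B.drop j) (word K (z :: l)) *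
        wcoef₂ A (B.take j) (D (FreeAlgebra.ι K y)) := by
  classical
  rw [wcoef₂_outerRight_word]
  refine Finset.sum_congr rfl fun j _ => ?_
  rw [word_cons, wcoef_cons_ι_mul, wcoef_word]
  by_cases hz : z = y
  · simp [hz, eq_comm]
  · simp [hz, hy z hz]

theorem wcoef₂_derivation_word (hD : ∀ a b, D (a * b) = outerRight b (D a) + outerLeft a (D b))
    (hy : ∀ x, x ≠ y → D (FreeAlgebra.ι K x) = 0) (l A B : List X) :
    wcoef₂ A B (D (word K l)) = splitSum (fun w₁ w₂ => wcoef (w₁ ++ y :: w₂) (word K l))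
      (fun α β => wcoef₂ α β (D (FreeAlgebra.ι K y))) A B := by
  classical
  induction l generalizing A with
  | nil =>
    have apply_one : D (word K []) = 0 := by simpa using hD 1 1
    simp [splitSum, -word_nil, wcoef_word, apply_one]
  | cons z l ih =>
    rw [word_cons, hD, map_add, wcoef₂_outerRight_derivation_ι hy, word_cons]
    cases A with
    | nil => simp only [splitSum_nil, wcoef₂_nil_outerLeft_ι, List.nil_append, add_zero]
    | cons x A =>
      rw [splitSum_cons, wcoef₂_cons_outerLeft_ι, ih]
      simp only [List.nil_append, List.cons_append, wcoef_cons_ι_mul]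
      by_cases hz : z = x
      · simp only [if_pos hz]
      · simp only [if_neg hz, splitSum_zero_left]

theorem wcoef₂_derivation (hD : ∀ a b, D (a * b) = outerRight b (D a) + outerLeft a (D b))
    (hy : ∀ x, x ≠ y → D (FreeAlgebra.ι K x) = 0) (A B : List X) (a : FreeAlgebra K X) :
    wcoef₂ A B (D a) = splitSum (fun w₁ w₂ => wcoef (w₁ ++ y :: w₂) a)
      (fun α β => wcoef₂ α β (D (FreeAlgebra.ι K y))) A B := by
  have on_words : wcoef₂ A B ∘ₗ D = ∑ i ∈ Finset.range (A.length + 1),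
      ∑ j ∈ Finset.range (B.length + 1), wcoef₂ (A.drop i) (B.take j) (D (FreeAlgebra.ι K y)) •
        wcoef (A.take i ++ y :: B.drop j) := by
    refine ext_of_word fun l => ?_
    simp only [LinearMap.comp_apply, wcoef₂_derivation_word hD hy, splitSum, LinearMap.sum_apply,
      LinearMap.smul_apply, smul_eq_mul, mul_comm]
  simpa only [LinearMap.comp_apply, LinearMap.sum_apply, LinearMap.smul_apply, smul_eq_mul,
    splitSum, mul_comm] using LinearMap.congr_fun on_words a

theorem wcoef₃_leftExt (hD : ∀ a b, D (a * b) = outerRight b (D a) + outerLeft a (D b))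
    (hy : ∀ x, x ≠ y → D (FreeAlgebra.ι K x) = 0) (A B C : List X)
    (t : FreeAlgebra K X ⊗[K] FreeAlgebra K X) :
    wcoef₃ A B C (leftExt D t) = splitSum (fun w₁ w₂ => wcoef₂ (w₁ ++ y :: w₂) C t)
      (fun α β => wcoef₂ α β (D (FreeAlgebra.ι K y))) A B := by
  induction t using TensorProduct.induction_on with
  | zero => simp [splitSum]
  | add s t hs ht => simp only [map_add, hs, ht, splitSum, add_mul, Finset.sum_add_distrib]
  | tmul a c =>
    rw [leftExt_tmul, wcoef₃_assoc_tmul, wcoef₂_derivation hD hy]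
    simp only [splitSum, wcoef₂_tmul, Finset.sum_mul, mul_right_comm]

theorem wcoef₃_rightExt (hD : ∀ a b, D (a * b) = outerRight b (D a) + outerLeft a (D b))
    (hy : ∀ x, x ≠ y → D (FreeAlgebra.ι K x) = 0) (A B C : List X)
    (t : FreeAlgebra K X ⊗[K] FreeAlgebra K X) :
    wcoef₃ A B C (rightExt D t) = splitSum (fun w₁ w₂ => wcoef₂ A (w₁ ++ y :: w₂) t)
      (fun α β => wcoef₂ α β (D (FreeAlgebra.ι K y))) B C := by
  induction t using TensorProduct.induction_on with
  | zero => simp [splitSum]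
  | add s t hs ht => simp only [map_add, hs, ht, splitSum, add_mul, Finset.sum_add_distrib]
  | tmul a c =>
    rw [rightExt_tmul, wcoef₃_tmul, wcoef₂_derivation hD hy]
    simp only [splitSum, wcoef₂_tmul, Finset.mul_sum, mul_assoc]

end DerivationCoefficients

section LeadingTerms

variable {K : Type*} [Field K] {X : Type*}

/-- The weight of a pair of words, for the leading term arguments: a size `m` of the first word,
then the two lengths to break ties. -/
def pairWeight (m : List X → ℕ) (p : List X × List X) : ℕ ×ₗ ℕ ×ₗ ℕ :=
  toLex (m p.1, toLex (p.1.length, p.2.length))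

variable {m : List X → ℕ}

theorem pairWeight_append (hm : ∀ v w, m (v ++ w) = m v + m w) (w₁ w₂ α β : List X) :
    pairWeight m (w₁ ++ α, β ++ w₂) = pairWeight m (w₁, w₂) + pairWeight m (α, β) := by
  simp only [pairWeight, hm, List.length_append, ← toLex_add, Prod.mk_add_mk, add_comm β.length]

theorem le_of_pairWeight_le {p q : List X × List X} (h : pairWeight m p ≤ pairWeight m q) :
    m p.1 ≤ m q.1 := by
  rcases Prod.Lex.le_iff.1 h with h | h
  exacts [h.le, h.1.le]

variable {f γ : List X → List X → K}

theorem splitSum_append (hm : ∀ v w, m (v ++ w) = m v + m w) {u₁ u₂ a b : List X}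
    (hf : ∀ w₁ w₂, f w₁ w₂ ≠ 0 → pairWeight m (w₁, w₂) ≤ pairWeight m (u₁, u₂))
    (hγ : ∀ α β, γ α β ≠ 0 → pairWeight m (α, β) ≤ pairWeight m (a, b)) :
    splitSum f γ (u₁ ++ a) (b ++ u₂) = f u₁ u₂ * γ a b := by
  have unique_split (i) (hi : i ≤ (u₁ ++ a).length) (j) (hj : j ≤ (b ++ u₂).length)
      (hne : f ((u₁ ++ a).take i) ((b ++ u₂).drop j) *
        γ ((u₁ ++ a).drop i) ((b ++ u₂).take j) ≠ 0) : i = u₁.length ∧ j = b.length := by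
    have weights := pairWeight_append hm ((u₁ ++ a).take i) ((b ++ u₂).drop j)
      ((u₁ ++ a).drop i) ((b ++ u₂).take j)
    rw [List.take_append_drop, List.take_append_drop, pairWeight_append hm] at weights
    have left_weights := ((add_eq_add_iff_eq_and_eq (hf _ _ (left_ne_zero_of_mul hne))
      (hγ _ _ (right_ne_zero_of_mul hne))).1 weights.symm).1
    simp only [pairWeight, EmbeddingLike.apply_eq_iff_eq, Prod.mk.injEq, List.length_take,
      List.length_drop] at left_weights
    simp only [List.length_append] at hi hj left_weights
    omega
  rw [splitSum, Finset.sum_eq_single u₁.length, Finset.sum_eq_single b.length]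
  · rw [List.take_left, List.drop_left, List.drop_left, List.take_left]
  · intro j hj hne
    by_contra h
    exact hne (unique_split _ (by simp) j (Finset.mem_range_succ_iff.1 hj) h).2
  · simp
  · intro i hi hne
    refine Finset.sum_eq_zero fun j hj => ?_
    by_contra h
    exact hne (unique_split i (Finset.mem_range_succ_iff.1 hi) j
      (Finset.mem_range_succ_iff.1 hj) h).1
  · simp

theorem exists_splitSum_ne_zero (hm : ∀ v w, m (v ++ w) = m v + m w)
    (hf : {p : List X × List X | f p.1 p.2 ≠ 0}.Finite)
    (hγ : {p : List X × List X | γ p.1 p.2 ≠ 0}.Finite)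
    {w₁ w₂ α β : List X} (hw : f w₁ w₂ ≠ 0) (hα : γ α β ≠ 0) :
    ∃ A B, m w₁ + m α ≤ m A ∧ splitSum f γ A B ≠ 0 := by
  obtain ⟨⟨u₁, u₂⟩, hu, u_max⟩ := Set.exists_max_image _ (pairWeight m) hf ⟨(w₁, w₂), hw⟩
  obtain ⟨⟨a, b⟩, ha, a_max⟩ := Set.exists_max_image _ (pairWeight m) hγ ⟨(α, β), hα⟩
  refine ⟨u₁ ++ a, b ++ u₂, ?_, ?_⟩
  · rw [hm]
    exact add_le_add (le_of_pairWeight_le (u_max (w₁, w₂) hw))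
      (le_of_pairWeight_le (a_max (α, β) hα))
  · rw [splitSum_append hm (fun _ _ h => u_max (_, _) h) fun _ _ h => a_max (_, _) h]
    exact mul_ne_zero hu ha

theorem eq_zero_of_splitSum_eq_zero (hf : {p : List X × List X | f p.1 p.2 ≠ 0}.Finite)
    (hγ : {p : List X × List X | γ p.1 p.2 ≠ 0}.Finite) (hγ_ne : ∃ α β, γ α β ≠ 0)
    (h : ∀ A B, splitSum f γ A B = 0) (w₁ w₂ : List X) : f w₁ w₂ = 0 := by
  by_contra hw
  obtain ⟨α, β, hα⟩ := hγ_ne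
  obtain ⟨A, B, -, hne⟩ := exists_splitSum_ne_zero (m := 0) (by simp) hf hγ hw hα
  exact hne (h A B)

theorem finite_setOf_append_cons {p : List X → Prop} (hp : {w | p w}.Finite) (y : X) :
    {q : List X × List X | p (q.1 ++ y :: q.2)}.Finite := by
  refine (hp.biUnion fun w _ => (Set.finite_Iic w.length).image
    fun i => (w.take i, w.drop (i + 1))).subset ?_
  rintro ⟨w₁, w₂⟩ h
  simp only [Set.mem_iUnion]
  exact ⟨_, h, w₁.length, by simp, by simp⟩

theorem finite_support_append_cons_left
    {c : List X → List X → K} (hc : {p : List X × List X | c p.1 p.2 ≠ 0}.Finite) (y : X)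
    (C : List X) : {p : List X × List X | c (p.1 ++ y :: p.2) C ≠ 0}.Finite :=
  finite_setOf_append_cons (p := fun A => c A C ≠ 0)
    ((hc.image Prod.fst).subset fun A hA => ⟨(A, C), hA, rfl⟩) y

theorem finite_support_append_cons_right
    {c : List X → List X → K} (hc : {p : List X × List X | c p.1 p.2 ≠ 0}.Finite) (y : X)
    (A : List X) : {p : List X × List X | c A (p.1 ++ y :: p.2) ≠ 0}.Finite :=
  finite_setOf_append_cons (p := fun C => c A C ≠ 0)
    ((hc.image Prod.snd).subset fun C hC => ⟨(A, C), hC, rfl⟩) y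

theorem splitSum_reverse (f γ : List X → List X → K) (A B : List X) :
    splitSum f γ A B = splitSum (fun w₁ w₂ => f w₂.reverse w₁.reverse)
      (fun α β => γ β.reverse α.reverse) B.reverse A.reverse := by
  simp only [splitSum, List.length_reverse, List.take_reverse, List.drop_reverse,
    List.reverse_reverse]
  rw [Finset.sum_comm, ← Finset.sum_range_reflect]
  refine Finset.sum_congr rfl fun j _ => ?_
  rw [← Finset.sum_range_reflect]
  simp

end LeadingTerms

section SplitEquation

variable {K : Type*} [Field K] {X : Type*} {c : List X → List X → K} {y : X}

/-- The quadratic equation satisfied by the coefficients `c` of `D (ι y)` when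
`leftExt D (D (ι y)) = rightExt D (D (ι y))`, where `D` is an outer derivation vanishing on the
letters other than `y`. -/
def SplitEquation (y : X) (c : List X → List X → K) : Prop :=
  ∀ A B C : List X, splitSum (fun w₁ w₂ => c (w₁ ++ y :: w₂) C) c A B =
    splitSum (fun w₁ w₂ => c A (w₁ ++ y :: w₂)) c B C

theorem SplitEquation.reverse (h : SplitEquation y c) :
    SplitEquation y fun A B => c B.reverse A.reverse := by
  intro A B C
  have h := (h C.reverse B.reverse A.reverse).symm
  rw [splitSum_reverse, splitSum_reverse _ _ C.reverse] at h
  simpa using h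

variable [DecidableEq X]

theorem exists_append_cons_of_count_ne_zero {A : List X} (hA : A.count y ≠ 0) :
    ∃ w₁ w₂, A = w₁ ++ y :: w₂ ∧ A.count y = w₁.count y + 1 := by
  have mem_reverse : y ∈ A.reverse := by
    rwa [List.mem_reverse, ← List.count_pos_iff, Nat.pos_iff_ne_zero]
  obtain ⟨w₂, w₁, hrev, hw₂⟩ := List.eq_append_cons_of_mem mem_reverse
  have hA : A = w₁.reverse ++ y :: w₂.reverse := by
    rw [← A.reverse_reverse, hrev]
    simp
  exact ⟨_, _, hA, by simp [hA, List.count_eq_zero.2 hw₂]⟩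

theorem SplitEquation.count_left_le_one (h : SplitEquation y c)
    (hc : {p : List X × List X | c p.1 p.2 ≠ 0}.Finite) {A C : List X} (hAC : c A C ≠ 0) :
    A.count y ≤ 1 := by
  obtain ⟨⟨A₀, C₀⟩, h₀, count_max⟩ := Set.exists_max_image _
    (fun p : List X × List X => p.1.count y) hc ⟨(A, C), hAC⟩
  refine (count_max (A, C) hAC).trans ?_
  by_contra! hcount
  dsimp only at hcount h₀
  obtain ⟨w₁, w₂, hA₀, hw₁⟩ := exists_append_cons_of_count_ne_zero (y := y) (A := A₀) (by omega)
  obtain ⟨A', B', hA', hne⟩ := exists_splitSum_ne_zero (m := List.count y)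
    (f := fun w₁ w₂ => c (w₁ ++ y :: w₂) C₀) (fun _ _ => List.count_append)
    (finite_support_append_cons_left hc y C₀) hc
    (hA₀ ▸ h₀ : c (w₁ ++ y :: w₂) C₀ ≠ 0) h₀
  rw [h A' B' C₀] at hne
  obtain ⟨v₁, v₂, hv⟩ := exists_ne_zero_of_splitSum_ne_zero hne
  have := count_max (A', v₁ ++ y :: v₂) hv
  dsimp only at this hA'
  omega

theorem SplitEquation.count_right_le_one (h : SplitEquation y c)
    (hc : {p : List X × List X | c p.1 p.2 ≠ 0}.Finite) {A C : List X} (hAC : c A C ≠ 0) :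
    C.count y ≤ 1 := by
  have finite_reverse : {p : List X × List X | c p.2.reverse p.1.reverse ≠ 0}.Finite :=
    (hc.image fun p => (p.2.reverse, p.1.reverse)).subset
      fun p hp => ⟨(p.2.reverse, p.1.reverse), hp, by simp⟩
  have := h.reverse.count_left_le_one finite_reverse (A := C.reverse) (C := A.reverse)
    (by simpa using hAC)
  rwa [List.count_reverse] at this

end SplitEquation

section SmallSupport

variable {K : Type*} [Field K] {X : Type*} {c : List X → List X → K} {x y : X}

theorem mem_of_count_le_one [DecidableEq X] {l : List X} (hl : ∀ z ∈ l, z = x ∨ z = y)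
    (hx : l.count x ≤ 1) (hy : l.count y ≤ 1) : l ∈ [[], [x], [y], [x, y], [y, x]] := by
  match l with
  | [] => simp
  | [a] => rcases hl a (by simp) with rfl | rfl <;> simp
  | [a, b] =>
    rcases hl a (by simp) with rfl | rfl <;> rcases hl b (by simp) with rfl | rfl <;>
      simp_all
  | a :: b :: d :: l =>
    exfalso
    rcases hl a (by simp) with rfl | rfl <;> rcases hl b (by simp) with rfl | rfl <;>
      rcases hl d (by simp) with rfl | rfl <;> simp only [List.count_cons] at hx hy <;>
      split_ifs at hx hy <;> simp_all

theorem SplitEquation.left_pair_eq_zero (h : SplitEquation y c) (hxy : x ≠ y)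
    (hl : ∀ A C, A ∉ [[], [x], [y], [x, y], [y, x]] → c A C = 0) (C : List X) :
    c [x, y] C = 0 := by
  have right_side : splitSum (fun w₁ w₂ => c [x, x, y] (w₁ ++ y :: w₂)) c C C = 0 := by
    simp only [hl [x, x, y] _ (by simp), splitSum_zero_left]
  have left_side : splitSum (fun w₁ w₂ => c (w₁ ++ y :: w₂) C) c [x, x, y] C =
      c [x, y] C * c [x, y] C := by
    rw [splitSum_cons, splitSum_of_left_nil]
    · simp only [hl [x, x, y] _ (by simp), mul_zero, Finset.sum_const_zero, zero_add]
      exact sum_take_drop_of_nil (f := fun w => c (x :: [] ++ y :: w) C)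
        (fun w hw => hl _ _ (by simp [hw])) (c [x, y]) C
    · rintro (_ | ⟨a, w₁⟩) w₂ hw
      · contradiction
      · exact hl _ _ (by simp [hxy])
  exact mul_self_eq_zero.1 (left_side.symm.trans ((h _ _ _).trans right_side))

theorem SplitEquation.reduced (h : SplitEquation y c) (hxy : x ≠ y)
    (hl : ∀ A C, A ∉ [[], [x], [y], [y, x]] → c A C = 0)
    (hr : ∀ A C, C ∉ [[], [x], [y], [x, y]] → c A C = 0) (A B C : List X) :
    ∑ j ∈ Finset.range (B.length + 1), c (y :: B.drop j) C * c A (B.take j) =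
      ∑ i ∈ Finset.range (B.length + 1), c A (B.take i ++ [y]) * c (B.drop i) C := by
  have left_vanish (w₁ w₂) (hw : w₁ ≠ []) : c (w₁ ++ y :: w₂) C = 0 := by
    refine hl _ _ ?_
    rcases w₁ with _ | ⟨a, _ | ⟨b, w⟩⟩ <;> simp_all [hxy.symm]
  have right_vanish (w₁ w₂) (hw : w₂ ≠ []) : c A (w₁ ++ y :: w₂) = 0 := by
    refine hr _ _ ?_
    rcases w₁ with _ | ⟨a, _ | ⟨b, w⟩⟩ <;> simp_all [hxy.symm]
  have := h A B C
  rwa [splitSum_of_left_nil left_vanish, splitSum_of_right_nil right_vanish] at this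

theorem SplitEquation.relations (h : SplitEquation y c) (hxy : x ≠ y)
    (hl : ∀ A C, A ∉ [[], [x], [y], [y, x]] → c A C = 0)
    (hr : ∀ A C, C ∉ [[], [x], [y], [x, y]] → c A C = 0) (A C : List X) :
    c A [x] * c [y, x] C = c A [x, y] * c [x] C ∧
    c A [x] * c [y] C + c A [] * c [y, x] C = c A [y] * c [x] C + c A [x, y] * c [] C ∧
    c A [] * c [y] C = c A [y] * c [] C := by
  have at_nil := h.reduced hxy hl hr A [] C
  have at_x := h.reduced hxy hl hr A [x] C
  have at_xx := h.reduced hxy hl hr A [x, x] C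
  have yxx_eq_zero : c [y, x, x] C = 0 := hl _ _ (by simp)
  have xx_right_eq_zero : c A [x, x] = 0 := hr _ _ (by simp [hxy])
  have xx_left_eq_zero : c [x, x] C = 0 := hl _ _ (by simp [hxy])
  have xxy_eq_zero : c A [x, x, y] = 0 := hr _ _ (by simp)
  simp only [List.length_cons, List.length_nil, Finset.sum_range_succ, Finset.range_one,
    Finset.sum_singleton, List.drop_zero, List.take_zero, List.drop_succ_cons,
    List.take_succ_cons, List.nil_append, List.cons_append, List.drop_nil, zero_add, yxx_eq_zero,
    xx_right_eq_zero, xx_left_eq_zero, xxy_eq_zero, zero_mul, mul_zero, add_zero]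
    at at_nil at_x at_xx
  refine ⟨?_, ?_, ?_⟩
  · linear_combination at_xx
  · linear_combination at_x
  · linear_combination at_nil

end SmallSupport

section ExchangeRelations

variable {K : Type*} [Field K] {I : Type*} {M : I → I → K}

theorem exists_eq_mul_mul_of_exchange
    (hM : ∀ a b i j, M i a * M b j = M i b * M a j) :
    ∃ (a : K) (w : I → K), ∀ i j, M i j = a * (w i * w j) := by
  by_cases hzero : ∀ i j, M i j = 0
  · exact ⟨0, 0, fun i j => by simp [hzero]⟩
  push Not at hzero
  obtain ⟨p, q, hpq⟩ := hzero
  have hpp : M p p ≠ 0 := by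
    have : M p q * M p q = M p p * M q q := hM q p p q
    exact left_ne_zero_of_mul (this ▸ mul_ne_zero hpq hpq)
  refine ⟨(M p p)⁻¹, M p, fun i j => ?_⟩
  rw [eq_inv_mul_iff_mul_eq₀ hpp, hM]

theorem row_eq_zero_of_exchange_add {b d m z : I} (hI : ∀ i, i = b ∨ i = d ∨ i = m ∨ i = z)
    (hbm : ∀ i j, M i b * M m j = M i m * M b j) (hdm : ∀ i j, M i d * M m j = M i m * M d j)
    (hsum : ∀ i j, M i b * M d j + M i z * M m j = M i d * M b j + M i m * M z j)
    (hmm : M m m = 0) (j : I) : M m j = 0 := by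
  have hb : M m b = 0 := mul_self_eq_zero.1 (by rw [hbm, hmm, zero_mul])
  have hd : M m d = 0 := mul_self_eq_zero.1 (by rw [hdm, hmm, zero_mul])
  have hz : M m z = 0 := mul_self_eq_zero.1 (by simpa [hb, hd, hmm] using hsum m z)
  rcases hI j with rfl | rfl | rfl | rfl <;> assumption

theorem exchange_of_exchange_add {b d m z : I} (hI : ∀ i, i = b ∨ i = d ∨ i = m ∨ i = z)
    (hbm : ∀ i j, M i b * M m j = M i m * M b j) (hdm : ∀ i j, M i d * M m j = M i m * M d j)
    (hsum : ∀ i j, M i b * M d j + M i z * M m j = M i d * M b j + M i m * M z j) (i j : I) :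
    M i z * M m j = M i m * M z j := by
  by_cases hmm : M m m = 0
  · have row : M m j = 0 := row_eq_zero_of_exchange_add hI hbm hdm hsum hmm j
    have column : M i m = 0 :=
      row_eq_zero_of_exchange_add (M := fun i j => M j i) hI
        (fun i j => by linear_combination -hbm j i) (fun i j => by linear_combination -hdm j i)
        (fun i j => by linear_combination -hsum j i) hmm i
    rw [row, column, mul_zero, zero_mul]
  · have hb : M m b = M b m := mul_right_cancel₀ hmm ((hbm m m).trans (mul_comm _ _))
    have hd : M m d = M d m := mul_right_cancel₀ hmm ((hdm m m).trans (mul_comm _ _))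
    have hbd : M i b * M d j = M i d * M b j := by
      refine mul_left_cancel₀ (mul_ne_zero hmm hmm) ?_
      linear_combination M m m * M d j * hbm i m - M m m * M b j * hdm i m
        - M i m * M b m * hdm m j + M i m * M d m * hbm m j
        + M i m * M m j * (M b m * hd - M d m * hb)
    linear_combination hsum i j - hbd

end ExchangeRelations

section SplitSquare

variable {K : Type*} [Field K] {X : Type*}

/-- The polynomial `r + t x + s y + q yx` in two letters `x` and `y`. -/
def splitFactor (x y : X) (q r s t : K) : FreeAlgebra K X :=
  r • 1 + t • FreeAlgebra.ι K x + s • FreeAlgebra.ι K y +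
    q • (FreeAlgebra.ι K y * FreeAlgebra.ι K x)

/-- The tensor `(r + t x + s y + q yx) ⊗ (r + t x + s y + q xy)`. Up to scalars these are exactly
the values of Poisson brackets on a pair of letters, and every one of the five normal forms is
of this shape. -/
def splitSquare (x y : X) (q r s t : K) : FreeAlgebra K X ⊗[K] FreeAlgebra K X :=
  splitFactor x y q r s t ⊗ₜ[K] splitFactor y x q r t s

theorem map_splitFactor {x y x' y' : X} {μ ν : K} {f : FreeAlgebra K X →ₐ[K] FreeAlgebra K X}
    (hx : f (FreeAlgebra.ι K x) = FreeAlgebra.ι K x' + algebraMap K _ μ)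
    (hy : f (FreeAlgebra.ι K y) = FreeAlgebra.ι K y' + algebraMap K _ ν) (q r s t : K) :
    f (splitFactor x y q r s t) =
      splitFactor x' y' q (r + s * ν + t * μ + q * μ * ν) (s + q * μ) (t + q * ν) := by
  simp only [splitFactor, map_add, map_smul, map_mul, map_one, hx, hy,
    Algebra.algebraMap_eq_smul_one, mul_add, add_mul, smul_add, smul_mul_assoc, mul_smul_comm,
    one_mul, mul_one, smul_smul, add_smul]
  module

theorem diag_splitSquare {x y x' y' : X} {μ ν : K} {f : FreeAlgebra K X →ₐ[K] FreeAlgebra K X}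
    (hx : f (FreeAlgebra.ι K x) = FreeAlgebra.ι K x' + algebraMap K _ μ)
    (hy : f (FreeAlgebra.ι K y) = FreeAlgebra.ι K y' + algebraMap K _ ν) (q r s t : K) :
    diag f (splitSquare x y q r s t) =
      splitSquare x' y' q (r + s * ν + t * μ + q * μ * ν) (s + q * μ) (t + q * ν) := by
  rw [splitSquare, diag_tmul, map_splitFactor hx hy, map_splitFactor hy hx, splitSquare,
    add_right_comm r, mul_right_comm]

theorem flip_splitSquare (x y : X) (q r s t : K) :
    flip (splitSquare x y q r s t) = splitSquare y x q r t s := rfl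

/-- The words `1`, `x`, `y` and `yx`. -/
def splitWord (x y : X) : Fin 4 → List X := ![[], [x], [y], [y, x]]

theorem splitFactor_eq_sum (x y : X) (q r s t : K) :
    splitFactor x y q r s t = ∑ i, ![r, t, s, q] i • word K (splitWord x y i) := by
  simp [splitFactor, splitWord, word, Fin.sum_univ_four]

theorem splitFactor_swap_eq_sum (x y : X) (q r s t : K) :
    splitFactor y x q r t s = ∑ i, ![r, t, s, q] i • word K (splitWord x y i).reverse := by
  rw [splitFactor, add_right_comm (r • 1)]
  simp [splitWord, word, Fin.sum_univ_four]

theorem splitWord_injective {x y : X} (hxy : x ≠ y) : Function.Injective (splitWord x y) := by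
  intro i j
  fin_cases i <;> fin_cases j <;> simp [splitWord, hxy, hxy.symm]

theorem wcoef_sum_smul_word {ι : Type*} [Fintype ι] {ρ : ι → List X} (hρ : ρ.Injective)
    (w : ι → K) (i : ι) : wcoef (ρ i) (∑ j, w j • word K (ρ j)) = w i := by
  classical
  simp [wcoef_word, hρ.eq_iff]

theorem wcoef_sum_smul_word_of_ne {ι : Type*} [Fintype ι] {ρ : ι → List X} {A : List X}
    (hA : ∀ i, A ≠ ρ i) (w : ι → K) : wcoef A (∑ j, w j • word K (ρ j)) = 0 := by
  classical
  simp [wcoef_word, (hA _).symm]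

theorem eq_smul_tmul_of_wcoef₂ {ι : Type*} [Fintype ι] {ρ σ : ι → List X} (hρ : ρ.Injective)
    (hσ : σ.Injective) {g : FreeAlgebra K X ⊗[K] FreeAlgebra K X} {a : K} {w : ι → K}
    (hg : ∀ i j, wcoef₂ (ρ i) (σ j) g = a * (w i * w j))
    (hsupp : ∀ A B, wcoef₂ A B g ≠ 0 → (∃ i, A = ρ i) ∧ ∃ j, B = σ j) :
    g = a • (∑ i, w i • word K (ρ i)) ⊗ₜ[K] (∑ j, w j • word K (σ j)) := by
  refine ext_wcoef₂ fun A B => ?_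
  rw [map_smul, wcoef₂_tmul, smul_eq_mul]
  by_cases hA : ∃ i, A = ρ i
  · by_cases hB : ∃ j, B = σ j
    · obtain ⟨⟨i, rfl⟩, j, rfl⟩ := And.intro hA hB
      rw [hg, wcoef_sum_smul_word hρ, wcoef_sum_smul_word hσ]
    · rw [wcoef_sum_smul_word_of_ne (not_exists.1 hB), mul_zero, mul_zero]
      by_contra h
      exact hB (hsupp A B h).2
  · rw [wcoef_sum_smul_word_of_ne (not_exists.1 hA), zero_mul, mul_zero]
    by_contra h
    exact hA (hsupp A B h).1

end SplitSquare

section Classification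

variable {K : Type*} [Field K] {X : Type*} {c : List X → List X → K} {x y : X}

theorem SplitEquation.mem_of_ne_zero (hy : SplitEquation y c)
    (hx : SplitEquation x fun A B => c B A) (hxy : x ≠ y)
    (hc : {p : List X × List X | c p.1 p.2 ≠ 0}.Finite)
    (letters : ∀ A B, c A B ≠ 0 → ∀ z ∈ A ++ B, z = x ∨ z = y) {A B : List X} (hAB : c A B ≠ 0) :
    A ∈ [[], [x], [y], [y, x]] ∧ B ∈ [[], [x], [y], [x, y]] := by
  classical
  have hc' : {p : List X × List X | c p.2 p.1 ≠ 0}.Finite :=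
    (hc.image Prod.swap).subset fun p hp => ⟨p.swap, hp, p.swap_swap⟩
  have left_mem (A B) (hAB : c A B ≠ 0) : A ∈ [[], [x], [y], [x, y], [y, x]] :=
    mem_of_count_le_one (fun z hz => letters A B hAB z (List.mem_append_left _ hz))
      (hx.count_right_le_one hc' hAB) (hy.count_left_le_one hc hAB)
  have right_mem (A B) (hAB : c A B ≠ 0) : B ∈ [[], [y], [x], [y, x], [x, y]] :=
    mem_of_count_le_one (fun z hz => (letters A B hAB z (List.mem_append_right _ hz)).symm)
      (hy.count_right_le_one hc hAB) (hx.count_left_le_one hc' hAB)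
  have left_ne : A ≠ [x, y] := by
    rintro rfl
    exact hAB (hy.left_pair_eq_zero hxy (fun A C => not_imp_comm.1 (left_mem A C)) B)
  have right_ne : B ≠ [y, x] := by
    rintro rfl
    exact hAB (hx.left_pair_eq_zero hxy.symm (fun A C => not_imp_comm.1 (right_mem C A)) A)
  have := left_mem A B hAB
  have := right_mem A B hAB
  simp_all only [List.mem_cons, List.not_mem_nil, ne_eq, false_or, or_false]
  tauto

theorem SplitEquation.exists_eq_mul_mul (hy : SplitEquation y c)
    (hx : SplitEquation x fun A B => c B A) (hxy : x ≠ y)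
    (supp : ∀ A B, c A B ≠ 0 → A ∈ [[], [x], [y], [y, x]] ∧ B ∈ [[], [x], [y], [x, y]]) :
    ∃ (a : K) (w : Fin 4 → K), ∀ i j,
      c (splitWord x y i) (splitWord x y j).reverse = a * (w i * w j) := by
  have left_supp (A B) : A ∉ [[], [x], [y], [y, x]] → c A B = 0 := not_imp_comm.1 fun h =>
    (supp A B h).1
  have right_supp (A B) : B ∉ [[], [x], [y], [x, y]] → c A B = 0 := not_imp_comm.1 fun h =>
    (supp A B h).2
  have rel_y := hy.relations hxy left_supp right_supp
  have rel_x := hx.relations hxy.symm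
    (fun A C hA => right_supp C A (by simpa [or_left_comm] using hA))
    (fun A C hC => left_supp C A (by simpa [or_left_comm] using hC))
  set M : Fin 4 → Fin 4 → K := fun i j => c (splitWord x y i) (splitWord x y j).reverse
  have h13 (i j) : M i 1 * M 3 j = M i 3 * M 1 j := (rel_y _ _).1
  have h02 (i j) : M i 0 * M 2 j = M i 2 * M 0 j := (rel_y _ _).2.2
  have hsum (i j) : M i 1 * M 2 j + M i 0 * M 3 j = M i 2 * M 1 j + M i 3 * M 0 j :=
    (rel_y _ _).2.1
  have h23 (i j) : M i 2 * M 3 j = M i 3 * M 2 j :=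
    (mul_comm _ _).trans ((rel_x _ _).1.symm.trans (mul_comm _ _))
  have h01 (i j) : M i 0 * M 1 j = M i 1 * M 0 j :=
    (mul_comm _ _).trans ((rel_x _ _).2.2.symm.trans (mul_comm _ _))
  have h03 := exchange_of_exchange_add (by decide) h13 h23 hsum
  have h12 (i j) : M i 1 * M 2 j = M i 2 * M 1 j := by
    linear_combination hsum i j - h03 i j
  refine exists_eq_mul_mul_of_exchange fun a b i j => ?_
  have lt_case (a b : Fin 4) (hab : a < b) : M i a * M b j = M i b * M a j := by
    fin_cases a <;> fin_cases b <;> first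
      | exact absurd hab (by decide)
      | exact h01 i j
      | exact h02 i j
      | exact h03 i j
      | exact h12 i j
      | exact h13 i j
      | exact h23 i j
  rcases lt_trichotomy a b with hab | rfl | hba
  exacts [lt_case a b hab, rfl, (lt_case b a hba).symm]

theorem exists_eq_smul_splitSquare {g : FreeAlgebra K X ⊗[K] FreeAlgebra K X} (hxy : x ≠ y)
    (hy : SplitEquation y fun A B => wcoef₂ A B g) (hx : SplitEquation x fun A B => wcoef₂ B A g)
    (letters : ∀ A B, wcoef₂ A B g ≠ 0 → ∀ z ∈ A ++ B, z = x ∨ z = y) :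
    ∃ a q r s t : K, g = a • splitSquare x y q r s t := by
  have supp (A B) (h : wcoef₂ A B g ≠ 0) :=
    hy.mem_of_ne_zero hx hxy (finite_support_wcoef₂ g) letters h
  obtain ⟨a, w, hw⟩ := hy.exists_eq_mul_mul hx hxy supp
  refine ⟨a, w 3, w 0, w 2, w 1, ?_⟩
  have w_eq : w = ![w 0, w 1, w 2, w 3] := List.ofFn_injective rfl
  rw [splitSquare, splitFactor_eq_sum, splitFactor_swap_eq_sum, ← w_eq]
  refine eq_smul_tmul_of_wcoef₂ (splitWord_injective hxy)
    (List.reverse_injective.comp (splitWord_injective hxy)) hw fun A B h => ?_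
  simpa [splitWord, Fin.exists_fin_succ] using supp A B h

end Classification

section DerivationSplitSquare

variable {K : Type*} [Field K] {X : Type*}
  {D : FreeAlgebra K X →ₗ[K] FreeAlgebra K X ⊗[K] FreeAlgebra K X} {x y : X}

theorem splitFactor_mul (x y : X) (q r s t : K) :
    splitFactor y x q r t s * (s • 1 + q • FreeAlgebra.ι K x) =
      (s • 1 + q • FreeAlgebra.ι K x) * splitFactor x y q r s t := by
  simp only [splitFactor, mul_add, add_mul, smul_mul_assoc, mul_smul_comm, one_mul, mul_one,
    smul_smul, smul_add, mul_assoc]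
  module

theorem derivation_splitFactor (hD : ∀ a b, D (a * b) = outerRight b (D a) + outerLeft a (D b))
    (hx : D (FreeAlgebra.ι K x) = 0) (q r s t : K) :
    D (splitFactor x y q r s t) =
      outerRight (s • 1 + q • FreeAlgebra.ι K x) (D (FreeAlgebra.ι K y)) := by
  have map_one : D 1 = 0 := by simpa using hD 1 1
  simp [splitFactor, hD, hx, map_one, outerRight_add, outerRight_smul]

theorem derivation_splitFactor_swap
    (hD : ∀ a b, D (a * b) = outerRight b (D a) + outerLeft a (D b))
    (hx : D (FreeAlgebra.ι K x) = 0) (q r s t : K) :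
    D (splitFactor y x q r t s) =
      outerLeft (s • 1 + q • FreeAlgebra.ι K x) (D (FreeAlgebra.ι K y)) := by
  have map_one : D 1 = 0 := by simpa using hD 1 1
  simp [splitFactor, hD, hx, map_one, outerLeft_add, outerLeft_smul]

theorem leftExt_eq_rightExt_of_splitSquare
    (hD : ∀ a b, D (a * b) = outerRight b (D a) + outerLeft a (D b))
    (hx : D (FreeAlgebra.ι K x) = 0) {a q r s t : K}
    (hy : D (FreeAlgebra.ι K y) = a • splitSquare x y q r s t) :
    leftExt D (D (FreeAlgebra.ι K y)) = rightExt D (D (FreeAlgebra.ι K y)) := by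
  rw [hy, splitSquare, map_smul, map_smul, leftExt_tmul, rightExt_tmul,
    derivation_splitFactor hD hx, derivation_splitFactor_swap hD hx, hy, map_smul, map_smul,
    splitSquare, outerRight_tmul, outerLeft_tmul, splitFactor_mul, TensorProduct.tmul_smul,
    ← TensorProduct.smul_tmul', map_smul, TensorProduct.assoc_tmul]

theorem leftExt_splitSquare_eq_zero
    (hD : ∀ a b, D (a * b) = outerRight b (D a) + outerLeft a (D b))
    (hx : D (FreeAlgebra.ι K x) = 0) (hy : D (FreeAlgebra.ι K y) = 0) (q r s t : K) :
    leftExt D (splitSquare x y q r s t) = 0 := by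
  rw [splitSquare, leftExt_tmul, derivation_splitFactor hD hx, hy, map_zero,
    TensorProduct.zero_tmul, map_zero]

end DerivationSplitSquare

section PairedBracket

variable {K : Type*} [Field K] {X : Type*} {τ : X → X}
  {P : FreeAlgebra K X →ₗ[K] FreeAlgebra K X →ₗ[K] FreeAlgebra K X ⊗[K] FreeAlgebra K X}

/-- A skewsymmetric double bracket on a free algebra for which every generator `x` brackets
nontrivially with at most one generator, its partner `τ x`. -/
structure IsPairedBracket (τ : X → X)
    (P : FreeAlgebra K X →ₗ[K] FreeAlgebra K X →ₗ[K] FreeAlgebra K X ⊗[K] FreeAlgebra K X) :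
    Prop where
  bracket : IsDoubleBracket P
  skew : ∀ a b, P a b = -flip (P b a)
  apply_ι_of_ne : ∀ x y, y ≠ τ x → P (FreeAlgebra.ι K x) (FreeAlgebra.ι K y) = 0

namespace IsPairedBracket

theorem ext {Q : FreeAlgebra K X →ₗ[K] FreeAlgebra K X →ₗ[K] FreeAlgebra K X ⊗[K] FreeAlgebra K X}
    (hP : IsPairedBracket τ P) (hQ : IsPairedBracket τ Q)
    (h : ∀ x, P (FreeAlgebra.ι K x) (FreeAlgebra.ι K (τ x)) =
      Q (FreeAlgebra.ι K x) (FreeAlgebra.ι K (τ x))) : P = Q := by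
  refine hP.bracket.ext_of_ι hQ.bracket fun x y => ?_
  by_cases hy : y = τ x
  · rw [hy, h]
  · rw [hP.apply_ι_of_ne x y hy, hQ.apply_ι_of_ne x y hy]

theorem equivariant (hP : IsPairedBracket τ P) {S : FreeAlgebra K X →ₐ[K] FreeAlgebra K X}
    {f : X → X} (hS : ∀ x, S (FreeAlgebra.ι K x) = FreeAlgebra.ι K (f x)) (hf : f.Injective)
    (hfτ : ∀ x, f (τ x) = τ (f x))
    (h : ∀ x, P (FreeAlgebra.ι K (f x)) (FreeAlgebra.ι K (τ (f x))) =
      diag S (P (FreeAlgebra.ι K x) (FreeAlgebra.ι K (τ x)))) (a b : FreeAlgebra K X) :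
    P (S a) (S b) = diag S (P a b) := by
  refine hP.bracket.equivariant_of_ι S (fun x y => ?_) a b
  rw [hS, hS]
  by_cases hy : y = τ x
  · rw [hy, hfτ, h]
  · rw [hP.apply_ι_of_ne x y hy, map_zero, hP.apply_ι_of_ne _ _ (hfτ x ▸ hf.ne hy)]

end IsPairedBracket

theorem exists_isPairedBracket (hτ : τ.Involutive)
    {φ : X → FreeAlgebra K X ⊗[K] FreeAlgebra K X} (hφ : ∀ x, φ (τ x) = -flip (φ x)) :
    ∃ P : FreeAlgebra K X →ₗ[K] FreeAlgebra K X →ₗ[K] FreeAlgebra K X ⊗[K] FreeAlgebra K X,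
      IsPairedBracket τ P ∧ ∀ x, P (FreeAlgebra.ι K x) (FreeAlgebra.ι K (τ x)) = φ x := by
  classical
  obtain ⟨P, hP, hPι⟩ := exists_isDoubleBracket fun x y => if y = τ x then φ x else 0
  refine ⟨P, ⟨hP, hP.skew_of_ι fun x y => ?_, fun x y hy => by rw [hPι, if_neg hy]⟩,
    fun x => by rw [hPι, if_pos rfl]⟩
  simp only [hPι]
  by_cases hy : y = τ x
  · rw [if_pos hy, if_pos (by rw [hy, hτ x]), hy, hφ, map_neg, flip_flip, neg_neg]
  · rw [if_neg hy, if_neg fun hx => hy (by rw [hx, hτ y]), map_zero, neg_zero]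

namespace IsPairedBracket

theorem eq_zero_of_leftExt_eq_zero (hP : IsPairedBracket τ P) {x : X}
    (hx : P (FreeAlgebra.ι K x) (FreeAlgebra.ι K (τ x)) ≠ 0)
    {t : FreeAlgebra K X ⊗[K] FreeAlgebra K X} (ht : leftExt (P (FreeAlgebra.ι K x)) t = 0)
    (w₁ w₂ C : List X) : wcoef₂ (w₁ ++ τ x :: w₂) C t = 0 := by
  refine eq_zero_of_splitSum_eq_zero
    (f := fun w₁ w₂ => wcoef₂ (w₁ ++ τ x :: w₂) C t)
    (finite_support_append_cons_left (c := fun A B => wcoef₂ A B t) (finite_support_wcoef₂ t) _ C)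
    (finite_support_wcoef₂ _) (exists_wcoef₂_ne_zero hx) (fun A B => ?_) w₁ w₂
  rw [← wcoef₃_leftExt (hP.bracket.left _) (hP.apply_ι_of_ne x), ht, map_zero]

theorem eq_zero_of_rightExt_eq_zero (hP : IsPairedBracket τ P) {x : X}
    (hx : P (FreeAlgebra.ι K x) (FreeAlgebra.ι K (τ x)) ≠ 0)
    {t : FreeAlgebra K X ⊗[K] FreeAlgebra K X} (ht : rightExt (P (FreeAlgebra.ι K x)) t = 0)
    (w₁ w₂ A : List X) : wcoef₂ A (w₁ ++ τ x :: w₂) t = 0 := by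
  refine eq_zero_of_splitSum_eq_zero
    (f := fun w₁ w₂ => wcoef₂ A (w₁ ++ τ x :: w₂) t)
    (finite_support_append_cons_right (c := fun A B => wcoef₂ A B t) (finite_support_wcoef₂ t) _ A)
    (finite_support_wcoef₂ _) (exists_wcoef₂_ne_zero hx) (fun B C => ?_) w₁ w₂
  rw [← wcoef₃_rightExt (hP.bracket.left _) (hP.apply_ι_of_ne x), ht, map_zero]

theorem splitEquation (hP : IsPairedBracket τ P) {x : X} (hx : τ x ≠ x)
    (hJ : jacobiator P (FreeAlgebra.ι K x) (FreeAlgebra.ι K x) (FreeAlgebra.ι K (τ x)) = 0) :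
    SplitEquation (τ x) fun A B =>
      wcoef₂ A B (P (FreeAlgebra.ι K x) (FreeAlgebra.ι K (τ x))) := by
  intro A B C
  rw [jacobiator_of_apply_eq_zero (hP.apply_ι_of_ne x x hx.symm), sub_eq_zero] at hJ
  rw [← wcoef₃_leftExt (hP.bracket.left _) (hP.apply_ι_of_ne x),
    ← wcoef₃_rightExt (hP.bracket.left _) (hP.apply_ι_of_ne x), hJ]

theorem splitEquation_flip (hP : IsPairedBracket τ P) (hτ : τ.Involutive) {x : X} (hx : τ x ≠ x)
    (hJ : jacobiator P (FreeAlgebra.ι K (τ x)) (FreeAlgebra.ι K (τ x)) (FreeAlgebra.ι K x) = 0) :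
    SplitEquation x fun A B =>
      wcoef₂ B A (P (FreeAlgebra.ι K x) (FreeAlgebra.ι K (τ x))) := by
  have h := hP.splitEquation (x := τ x) (by rwa [hτ x, ne_comm]) (by rwa [hτ x])
  rw [hτ x, hP.skew] at h
  simpa [SplitEquation, splitSum, wcoef₂_flip] using h

theorem letters (hP : IsPairedBracket τ P) (hτ : τ.Involutive)
    (hne : ∀ x, P (FreeAlgebra.ι K x) (FreeAlgebra.ι K (τ x)) ≠ 0)
    (hJ : ∀ x y z, jacobiator P (FreeAlgebra.ι K x) (FreeAlgebra.ι K y) (FreeAlgebra.ι K z) = 0)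
    {x : X} {A B : List X}
    (hAB : wcoef₂ A B (P (FreeAlgebra.ι K x) (FreeAlgebra.ι K (τ x))) ≠ 0) (z : X)
    (hz : z ∈ A ++ B) : z = x ∨ z = τ x := by
  by_contra! hzx
  have commute_left : P (FreeAlgebra.ι K (τ z)) (FreeAlgebra.ι K x) = 0 :=
    hP.apply_ι_of_ne _ _ (by simpa [hτ z] using hzx.1.symm)
  have commute_right : P (FreeAlgebra.ι K (τ z)) (FreeAlgebra.ι K (τ x)) = 0 :=
    hP.apply_ι_of_ne _ _ (by simpa [hτ z] using hzx.2.symm)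
  have commute_flip : P (FreeAlgebra.ι K x) (FreeAlgebra.ι K (τ z)) = 0 := by
    rw [hP.skew, commute_left, map_zero, neg_zero]
  have jacobi_left := hJ (τ z) x (τ x)
  rw [jacobiator_of_apply_eq_zero commute_left, commute_right, map_zero, sub_zero] at jacobi_left
  have jacobi_right := hJ x (τ z) (τ x)
  rw [jacobiator_of_apply_eq_zero commute_flip, commute_right, map_zero, zero_sub, neg_eq_zero]
    at jacobi_right
  rcases List.mem_append.1 hz with hz | hz <;> obtain ⟨w₁, w₂, rfl⟩ := List.append_of_mem hz
  · exact hAB (by simpa only [hτ z] using hP.eq_zero_of_leftExt_eq_zero (hne _) jacobi_left w₁ w₂ B)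
  · exact hAB
      (by simpa only [hτ z] using hP.eq_zero_of_rightExt_eq_zero (hne _) jacobi_right w₁ w₂ A)

theorem exists_eq_smul_splitSquare (hP : IsPairedBracket τ P) (hτ : τ.Involutive)
    (hτ_ne : ∀ x, τ x ≠ x) (hne : ∀ x, P (FreeAlgebra.ι K x) (FreeAlgebra.ι K (τ x)) ≠ 0)
    (hJ : ∀ x y z, jacobiator P (FreeAlgebra.ι K x) (FreeAlgebra.ι K y) (FreeAlgebra.ι K z) = 0)
    (x : X) : ∃ a q r s t : K,
      P (FreeAlgebra.ι K x) (FreeAlgebra.ι K (τ x)) = a • splitSquare x (τ x) q r s t :=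
  DoubleMPVA.exists_eq_smul_splitSquare (hτ_ne x).symm (hP.splitEquation (hτ_ne x) (hJ _ _ _))
    (hP.splitEquation_flip hτ (hτ_ne x) (hJ _ _ _)) fun _ _ => hP.letters hτ hne hJ

theorem jacobiator_partner_eq_zero (hP : IsPairedBracket τ P) {x : X} (hx : τ x ≠ x)
    {a q r s t : K}
    (h : P (FreeAlgebra.ι K x) (FreeAlgebra.ι K (τ x)) = a • splitSquare x (τ x) q r s t) :
    jacobiator P (FreeAlgebra.ι K x) (FreeAlgebra.ι K x) (FreeAlgebra.ι K (τ x)) = 0 := by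
  have hxx := hP.apply_ι_of_ne x x hx.symm
  rw [jacobiator_of_apply_eq_zero hxx, sub_eq_zero]
  exact leftExt_eq_rightExt_of_splitSquare (hP.bracket.left _) hxx h

theorem leftExt_eq_zero (hP : IsPairedBracket τ P) (hτ : τ.Involutive)
    (h : ∀ x, ∃ a q r s t : K,
      P (FreeAlgebra.ι K x) (FreeAlgebra.ι K (τ x)) = a • splitSquare x (τ x) q r s t)
    {x y z : X} (hxyz : ¬ (z = τ y ∧ (x = y ∨ x = τ y))) :
    leftExt (P (FreeAlgebra.ι K x)) (P (FreeAlgebra.ι K y) (FreeAlgebra.ι K z)) = 0 := by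
  by_cases hz : z = τ y
  · subst hz
    obtain ⟨a, q, r, s, t, h⟩ := h y
    simp only [true_and, not_or] at hxyz
    rw [h, map_smul, leftExt_splitSquare_eq_zero (hP.bracket.left _) (hP.apply_ι_of_ne _ _ ?_)
      (hP.apply_ι_of_ne _ _ fun h => hxyz.1 (hτ.injective h).symm), smul_zero]
    rintro rfl
    exact hxyz.2 (hτ x).symm
  · rw [hP.apply_ι_of_ne y z hz, map_zero]

theorem jacobiator_ι_eq_zero (hP : IsPairedBracket τ P) (hτ : τ.Involutive)
    (hτ_ne : ∀ x, τ x ≠ x) (h : ∀ x, ∃ a q r s t : K,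
      P (FreeAlgebra.ι K x) (FreeAlgebra.ι K (τ x)) = a • splitSquare x (τ x) q r s t)
    (x y z : X) :
    jacobiator P (FreeAlgebra.ι K x) (FreeAlgebra.ι K y) (FreeAlgebra.ι K z) = 0 := by
  have cyclic {x y z : X}
      (h : jacobiator P (FreeAlgebra.ι K y) (FreeAlgebra.ι K z) (FreeAlgebra.ι K x) = 0) :
      jacobiator P (FreeAlgebra.ι K x) (FreeAlgebra.ι K y) (FreeAlgebra.ι K z) = 0 := by
    rw [jacobiator_cyclic hP.skew, h, map_zero, map_zero]
  have partner (x) :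
      jacobiator P (FreeAlgebra.ι K x) (FreeAlgebra.ι K x) (FreeAlgebra.ι K (τ x)) = 0 := by
    obtain ⟨a, q, r, s, t, h⟩ := h x
    exact hP.jacobiator_partner_eq_zero (hτ_ne x) h
  have of_paired {x y z : X} (hxyz : z = τ y ∧ (x = y ∨ x = τ y)) :
      jacobiator P (FreeAlgebra.ι K x) (FreeAlgebra.ι K y) (FreeAlgebra.ι K z) = 0 := by
    obtain ⟨rfl, rfl | rfl⟩ := hxyz
    · exact partner x
    · exact cyclic (cyclic (by simpa only [hτ y] using partner (τ y)))
  by_cases hxyz : z = τ y ∧ (x = y ∨ x = τ y)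
  · exact of_paired hxyz
  by_cases hyzx : x = τ z ∧ (y = z ∨ y = τ z)
  · exact cyclic (of_paired hyzx)
  by_cases hzxy : y = τ x ∧ (z = x ∨ z = τ x)
  · exact cyclic (cyclic (of_paired hzxy))
  rw [jacobiator_eq_sum_rot hP.skew, hP.leftExt_eq_zero hτ h hxyz, hP.leftExt_eq_zero hτ h hyzx,
    hP.leftExt_eq_zero hτ h hzxy]
  simp only [map_zero, add_zero]

end IsPairedBracket

end PairedBracket

section R2

variable {K : Type*} [Field K]

theorem shift_ι (p : Fin 2 × ℤ) :
    shift K (FreeAlgebra.ι K p) = FreeAlgebra.ι K (p.1, p.2 + 1) :=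
  FreeAlgebra.lift_ι_apply _ _

theorem shift_zpow_ι (n : ℤ) (p : Fin 2 × ℤ) :
    (shift K ^ n) (FreeAlgebra.ι K p) = FreeAlgebra.ι K (p.1, p.2 + n) := by
  induction n using Int.induction_on with
  | zero => simp
  | succ n ih => rw [add_comm, zpow_one_add, AlgEquiv.mul_apply, ih, shift_ι, add_assoc, add_comm 1]
  | pred n ih =>
    apply (shift K).injective
    rw [← AlgEquiv.mul_apply, ← zpow_one_add, add_sub_cancel, ih, shift_ι, add_assoc,
      sub_add_cancel]

theorem not_isOfFinOrder_shift : ¬ IsOfFinOrder (shift K) := by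
  rw [isOfFinOrder_iff_pow_eq_one]
  rintro ⟨n, hn, h⟩
  have shift_n := shift_zpow_ι (K := K) n (0, 0)
  rw [zpow_natCast, h, AlgEquiv.one_apply] at shift_n
  have := congrArg Prod.snd (FreeAlgebra.ι_injective shift_n)
  lia

theorem IsDoubleBracket.finite_support_of_ι {X : Type*}
    {P : FreeAlgebra K X →ₗ[K] FreeAlgebra K X →ₗ[K] FreeAlgebra K X ⊗[K] FreeAlgebra K X}
    (hP : IsDoubleBracket P) (S : FreeAlgebra K X ≃ₐ[K] FreeAlgebra K X)
    (h : ∀ x y, (Function.support fun n : ℤ =>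
      P ((S ^ n) (FreeAlgebra.ι K x)) (FreeAlgebra.ι K y)).Finite) (a b : FreeAlgebra K X) :
    (Function.support fun n : ℤ => P ((S ^ n) a) b).Finite := by
  have apply_one (a) : P a 1 = 0 := by simpa using hP.left a 1 1
  have one_apply (b) : P 1 b = 0 := by simpa using hP.right 1 1 b
  have of_imp {f f' f'' : ℤ → FreeAlgebra K X ⊗[K] FreeAlgebra K X}
      (hf : f.support.Finite) (hf' : f'.support.Finite)
      (himp : ∀ n, f n = 0 → f' n = 0 → f'' n = 0) : f''.support.Finite := by
    refine (hf.union hf').subset fun n hn => ?_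
    by_contra! hn'
    simp only [Set.mem_union, Function.mem_support, not_or, not_not] at hn'
    exact hn (himp n hn'.1 hn'.2)
  induction a using FreeAlgebra.induction with
  | grade0 r => simp [Algebra.algebraMap_eq_smul_one, one_apply]
  | mul a a' ha ha' => exact of_imp ha ha' fun n h h' => by simp [hP.right, h, h']
  | add a a' ha ha' => exact of_imp ha ha' fun n h h' => by simp [h, h']
  | grade1 x =>
    induction b using FreeAlgebra.induction with
    | grade0 r => simp [Algebra.algebraMap_eq_smul_one, apply_one]
    | mul b b' hb hb' => exact of_imp hb hb' fun n h h' => by simp [hP.left, h, h']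
    | add b b' hb hb' => exact of_imp hb hb' fun n h h' => by simp [h, h']
    | grade1 y => exact h x y

/-- The involution exchanging `u_{n+k}` and `v_n`, the only pairs of generators with a nonzero
constant term of the `λ`-bracket when `{{u_λ v}} = g λᵏ`. -/
def partner (k : ℤ) : Fin 2 × ℤ → Fin 2 × ℤ
  | (0, n) => (1, n - k)
  | (1, n) => (0, n + k)

/-- The constant term of the `λ`-bracket of a generator with its partner when
`{{u_λ v}} = g λᵏ`. -/
def partnerValue (k : ℤ) (g : R2 K ⊗[K] R2 K) : Fin 2 × ℤ → R2 K ⊗[K] R2 K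
  | (0, n) => diagPow (shift K) (n - k) g
  | (1, n) => -flip (diagPow (shift K) n g)

theorem partner_involutive (k : ℤ) : (partner k).Involutive
  | (0, n) => by simp [partner]
  | (1, n) => by simp [partner]

theorem partner_ne (k : ℤ) : ∀ p, partner k p ≠ p
  | (0, n) => by simp [partner]
  | (1, n) => by simp [partner]

theorem partner_shift (k : ℤ) :
    ∀ p, ((partner k p).1, (partner k p).2 + 1) = partner k (p.1, p.2 + 1)
  | (0, n) => by simp [partner, add_sub_right_comm]
  | (1, n) => by simp [partner, add_right_comm]

variable {k : ℤ} {g : R2 K ⊗[K] R2 K}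

theorem partnerValue_partner : ∀ p, partnerValue k g (partner k p) = -flip (partnerValue k g p)
  | (0, n) => rfl
  | (1, n) => by simp [partner, partnerValue]

theorem partnerValue_shift :
    ∀ p, partnerValue k g (p.1, p.2 + 1) = diagPow (shift K) 1 (partnerValue k g p)
  | (0, n) => by simp [partnerValue, diagPow_diagPow, add_comm, add_sub_right_comm]
  | (1, n) => by simp [partnerValue, diagPow_flip, diagPow_diagPow, add_comm]

theorem partnerValue_eq_zero_iff (p : Fin 2 × ℤ) : partnerValue k g p = 0 ↔ g = 0 := by
  have diagPow_eq_zero (n : ℤ) : diagPow (shift K) n g = 0 ↔ g = 0 :=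
    ⟨fun h => by simpa [diagPow_diagPow] using congrArg (diagPow (shift K) (-n)) h,
      fun h => by rw [h, map_zero]⟩
  have flip_eq_zero (t : R2 K ⊗[K] R2 K) : flip t = 0 ↔ t = 0 :=
    (TensorProduct.comm K _ _).map_eq_zero_iff
  match p with
  | (0, n) => exact diagPow_eq_zero _
  | (1, n) => rw [partnerValue, neg_eq_zero, flip_eq_zero, diagPow_eq_zero]

variable {B : LambdaMap K (R2 K)}

theorem IsLambdaBracket.coeff_zero_ι (h : IsLambdaBracket (shift K) B) (e f : Fin 2) (i j : ℤ) :
    B.coeff 0 (FreeAlgebra.ι K (e, i)) (FreeAlgebra.ι K (f, j)) =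
      diagPow (shift K) j (B (FreeAlgebra.ι K (e, 0)) (FreeAlgebra.ι K (f, 0)) (i - j)) := by
  change _ = diagPow (shift K) j (B.coeff (i - j) _ _)
  rw [h.coeff_eq (i - j), ← h.coeff_zero_equivariant, ← AlgEquiv.mul_apply, ← zpow_add,
    shift_zpow_ι, shift_zpow_ι]
  simp

namespace IsMonomialBracket

theorem coeff_zero_uv (h : IsMonomialBracket k g B) (i j : ℤ) :
    B.coeff 0 (FreeAlgebra.ι K (0, i)) (FreeAlgebra.ι K (1, j)) =
      diagPow (shift K) j (Finsupp.single k g (i - j)) := by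
  rw [h.bracket.coeff_zero_ι, ← h.uv]
  rfl

theorem isPairedBracket (h : IsMonomialBracket k g B) :
    IsPairedBracket (partner k) (B.coeff 0) := by
  have uu : B (FreeAlgebra.ι K (0, 0)) (FreeAlgebra.ι K (0, 0)) = 0 := h.uu
  have vv : B (FreeAlgebra.ι K (1, 0)) (FreeAlgebra.ι K (1, 0)) = 0 := h.vv
  have uv (i j) (hij : i - j ≠ k) :
      B.coeff 0 (FreeAlgebra.ι K (0, i)) (FreeAlgebra.ι K (1, j)) = 0 := by
    rw [h.coeff_zero_uv, Finsupp.single_eq_of_ne hij, map_zero]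
  refine ⟨h.bracket.isDoubleBracket, h.skew.coeff_zero, ?_⟩
  rintro ⟨e, i⟩ ⟨f, j⟩ hne
  match e, f with
  | 0, 0 => rw [h.bracket.coeff_zero_ι, uu, Finsupp.zero_apply, map_zero]
  | 0, 1 => exact uv i j fun hij => hne (by rw [partner, ← hij, sub_sub_cancel])
  | 1, 0 =>
    rw [h.skew.coeff_zero, uv j i fun hij => hne (by rw [partner, ← hij, add_sub_cancel]),
      map_zero, neg_zero]
  | 1, 1 => rw [h.bracket.coeff_zero_ι, vv, Finsupp.zero_apply, map_zero]

theorem coeff_zero_partner (h : IsMonomialBracket k g B) : ∀ p,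
    B.coeff 0 (FreeAlgebra.ι K p) (FreeAlgebra.ι K (partner k p)) = partnerValue k g p
  | (0, n) => by
    rw [partner, h.coeff_zero_uv, sub_sub_cancel, Finsupp.single_eq_same, partnerValue]
  | (1, n) => by
    rw [partner, h.skew.coeff_zero, h.coeff_zero_uv, add_sub_cancel_left,
      Finsupp.single_eq_same, partnerValue]

end IsMonomialBracket

theorem isMonomialBracket_lambdaOfBracket
    {P : R2 K →ₗ[K] R2 K →ₗ[K] R2 K ⊗[K] R2 K} (hP : IsPairedBracket (partner k) P)
    (hPι : ∀ p, P (FreeAlgebra.ι K p) (FreeAlgebra.ι K (partner k p)) = partnerValue k g p)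
    (hS : ∀ a b, P (shift K a) (shift K b) = diagPow (shift K) 1 (P a b))
    (hfin : ∀ a b, (Function.support fun n : ℤ => P ((shift K ^ n) a) b).Finite) :
    IsMonomialBracket k g (lambdaOfBracket (shift K) P hfin) where
  bracket := isLambdaBracket_lambdaOfBracket hP.bracket hS
  skew := isSkew_lambdaOfBracket hS hP.skew
  uu := by
    ext n
    change P ((shift K ^ n) (FreeAlgebra.ι K (0, 0))) (FreeAlgebra.ι K (0, 0)) = 0
    rw [shift_zpow_ι, hP.apply_ι_of_ne _ _ (by simp [partner])]
  vv := by
    ext n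
    change P ((shift K ^ n) (FreeAlgebra.ι K (1, 0))) (FreeAlgebra.ι K (1, 0)) = 0
    rw [shift_zpow_ι, hP.apply_ι_of_ne _ _ (by simp [partner])]
  uv := by
    ext n
    change P ((shift K ^ n) (FreeAlgebra.ι K (0, 0))) (FreeAlgebra.ι K (1, 0)) = _
    rw [shift_zpow_ι, Finsupp.single_apply]
    split_ifs with hn
    · subst hn
      simpa [partner, partnerValue] using hPι (0, k)
    · exact hP.apply_ι_of_ne _ _ (by simp [partner]; lia)

theorem existsUnique_isMonomialBracket (k : ℤ) (g : R2 K ⊗[K] R2 K) :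
    ∃! B : LambdaMap K (R2 K), IsMonomialBracket k g B := by
  obtain ⟨P, hP, hPι⟩ :=
    exists_isPairedBracket (partner_involutive k) (partnerValue_partner (g := g))
  have equivariant : ∀ a b, P (shift K a) (shift K b) = diagPow (shift K) 1 (P a b) := by
    refine hP.equivariant (S := ((shift K ^ (1 : ℤ) : R2 K ≃ₐ[K] R2 K) : R2 K →ₐ[K] R2 K))
      (fun p => shift_zpow_ι 1 p) (fun p q h => ?_) (partner_shift k) fun p => ?_
    · simpa [Prod.ext_iff] using h
    · rw [hPι, hPι, partnerValue_shift]
      rfl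
  have finite_support : ∀ a b, (Function.support fun n : ℤ => P ((shift K ^ n) a) b).Finite := by
    refine hP.bracket.finite_support_of_ι _ fun p q =>
      (Set.finite_singleton ((partner k q).2 - p.2)).subset fun n hn => ?_
    rw [Function.mem_support, shift_zpow_ι] at hn
    have hq := not_imp_comm.1 (hP.apply_ι_of_ne _ q) hn
    simp [hq, partner_involutive k _]
  refine ⟨_, isMonomialBracket_lambdaOfBracket hP hPι equivariant finite_support, fun B hB => ?_⟩
  have coeff_zero : B.coeff 0 = P :=
    hB.isPairedBracket.ext hP fun p => by rw [hB.coeff_zero_partner, hPι]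
  refine LinearMap.ext fun a => LinearMap.ext fun b => Finsupp.ext fun n => ?_
  change B.coeff n a b = P ((shift K ^ n) a) b
  rw [hB.bracket.coeff_eq, coeff_zero]

theorem exists_partnerValue_eq_smul_splitSquare {a q r s t : K}
    (hg : g = a • splitSquare (0, k) (1, 0) q r s t) (p : Fin 2 × ℤ) :
    ∃ a q r s t : K, partnerValue k g p = a • splitSquare p (partner k p) q r s t := by
  have diagPow_g (n : ℤ) :
      diagPow (shift K) n g = a • splitSquare (0, n + k) (1, n) q r s t := by
    have shift_ι (p) : (shift K ^ n) (FreeAlgebra.ι K p) =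
        FreeAlgebra.ι K (p.1, p.2 + n) + algebraMap K _ 0 := by
      rw [shift_zpow_ι, map_zero, add_zero]
    rw [hg, map_smul, diagPow, diag_splitSquare (shift_ι _) (shift_ι _)]
    simp [add_comm]
  match p with
  | (0, n) => exact ⟨a, q, r, s, t, by rw [partnerValue, diagPow_g, sub_add_cancel, partner]⟩
  | (1, n) =>
    refine ⟨-a, q, r, t, s, ?_⟩
    rw [partnerValue, diagPow_g, map_smul, flip_splitSquare, partner]
    exact (neg_smul a (splitSquare (1, n) (0, n + k) q r t s)).symm

theorem IsMonomialBracket.isDoubleMPVA_iff (h : IsMonomialBracket k g B) :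
    IsDoubleMPVA (shift K) B ↔ ∀ p q r, jacobiator (B.coeff 0) (FreeAlgebra.ι K p)
      (FreeAlgebra.ι K q) (FreeAlgebra.ι K r) = 0 :=
  ⟨fun hB _ _ _ => h.bracket.isJacobi_iff.1 hB.jacobi _ _ _,
    fun hJ => ⟨not_isOfFinOrder_shift, h.bracket, h.skew, h.bracket.isJacobi_iff.2
      (jacobiator_eq_zero_of_ι h.bracket.isDoubleBracket h.skew.coeff_zero hJ)⟩⟩

theorem IsMonomialBracket.isDoubleMPVA_iff_exists_splitSquare (h : IsMonomialBracket k g B) :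
    IsDoubleMPVA (shift K) B ↔
      ∃ a q r s t : K, g = a • splitSquare (0, k) (1, 0) q r s t := by
  rw [h.isDoubleMPVA_iff]
  constructor
  · intro hJ
    by_cases hg : g = 0
    · exact ⟨0, 0, 0, 0, 0, by rw [hg, zero_smul]⟩
    have hne (p) : B.coeff 0 (FreeAlgebra.ι K p) (FreeAlgebra.ι K (partner k p)) ≠ 0 := by
      rwa [h.coeff_zero_partner, Ne, partnerValue_eq_zero_iff]
    have hg := h.isPairedBracket.exists_eq_smul_splitSquare (partner_involutive k) (partner_ne k)
      hne hJ (0, k)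
    rw [h.coeff_zero_partner] at hg
    simpa [partnerValue, partner] using hg
  · rintro ⟨a, q, r, s, t, hg⟩
    refine h.isPairedBracket.jacobiator_ι_eq_zero (partner_involutive k) (partner_ne k) fun p => ?_
    rw [h.coeff_zero_partner]
    exact exists_partnerValue_eq_smul_splitSquare hg p

end R2

section NormalForms

variable {K : Type*} [Field K]

theorem wcoef₂_smul_splitSquare {X : Type*} {x y : X} (hxy : x ≠ y) (a q r s t : K)
    (i j : Fin 4) :
    wcoef₂ (splitWord x y i) (splitWord x y j).reverse (a • splitSquare x y q r s t) =
      a * (![r, t, s, q] i * ![r, t, s, q] j) := by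
  have reverse_injective := List.reverse_injective.comp (splitWord_injective hxy)
  rw [map_smul, splitSquare, wcoef₂_tmul, splitFactor_eq_sum, splitFactor_swap_eq_sum,
    wcoef_sum_smul_word (splitWord_injective hxy), smul_eq_mul]
  exact congrArg (fun c => a * (_ * c)) (wcoef_sum_smul_word reverse_injective _ j)

theorem smul_splitSquare_linear {X : Type*} (x y : X) (a s t : K) :
    a • splitSquare x y 0 0 s t =
      (a * s ^ 2) • (FreeAlgebra.ι K y ⊗ₜ[K] FreeAlgebra.ι K y) +
        (a * (s * t)) • (FreeAlgebra.ι K y ⊗ₜ[K] FreeAlgebra.ι K x +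
          FreeAlgebra.ι K x ⊗ₜ[K] FreeAlgebra.ι K y) +
        (a * t ^ 2) • (FreeAlgebra.ι K x ⊗ₜ[K] FreeAlgebra.ι K x) := by
  simp only [splitSquare, splitFactor, zero_smul, zero_add, add_zero, TensorProduct.add_tmul,
    TensorProduct.tmul_add, ← TensorProduct.smul_tmul', TensorProduct.tmul_smul]
  module

theorem smul_splitSquare_quadratic {X : Type*} (x y : X) (a q r : K) :
    a • splitSquare x y q r 0 0 =
      (a * q ^ 2) • ((FreeAlgebra.ι K y * FreeAlgebra.ι K x) ⊗ₜ[K]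
          (FreeAlgebra.ι K x * FreeAlgebra.ι K y)) +
        (a * (q * r)) • ((FreeAlgebra.ι K y * FreeAlgebra.ι K x) ⊗ₜ[K] 1 +
          1 ⊗ₜ[K] (FreeAlgebra.ι K x * FreeAlgebra.ι K y)) +
        (a * r ^ 2) • ((1 : FreeAlgebra K X) ⊗ₜ[K] 1) := by
  simp only [splitSquare, splitFactor, zero_smul, add_zero, TensorProduct.add_tmul,
    TensorProduct.tmul_add, ← TensorProduct.smul_tmul', TensorProduct.tmul_smul]
  module

/-- Which of the five normal forms is reached from `splitSquare (0, k) (1, 0) q r s t`. -/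
def SplitType (q s t : K) : Fin 5 → Prop :=
  ![q = 0 ∧ s = 0 ∧ t = 0, q = 0 ∧ s ≠ 0 ∧ t = 0, q = 0 ∧ s = 0 ∧ t ≠ 0,
    q = 0 ∧ s ≠ 0 ∧ t ≠ 0, q ≠ 0]

theorem existsUnique_splitType (q s t : K) : ∃! i, SplitType q s t i := by
  by_cases hq : q = 0 <;> by_cases hs : s = 0 <;> by_cases ht : t = 0 <;>
    simp [SplitType, ExistsUnique, Fin.forall_fin_succ, hq, hs, ht]

theorem splitType_smul_sq_iff {a : K} (ha : a ≠ 0) (q s t : K) (i : Fin 5) :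
    SplitType (a * q ^ 2) (a * s ^ 2) (a * t ^ 2) i ↔ SplitType q s t i := by
  fin_cases i <;> simp [SplitType, ha]

theorem splitType_add_mul_iff (q s t μ ν : K) (i : Fin 5) :
    SplitType q (s + q * μ) (t + q * ν) i ↔ SplitType q s t i := by
  by_cases hq : q = 0
  · simp [hq]
  · fin_cases i <;> simp [SplitType, hq]

/-- The type of a multiple of a `splitSquare` on `u_k` and `v`, read off from the
coefficients of `vu_k ⊗ u_kv`, `v ⊗ v` and `u_k ⊗ u_k`. -/
def TensorType (k : ℤ) (g : R2 K ⊗[K] R2 K) : Fin 5 → Prop :=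
  SplitType (wcoef₂ [(1, 0), (0, k)] [(0, k), (1, 0)] g) (wcoef₂ [(1, 0)] [(1, 0)] g)
    (wcoef₂ [(0, k)] [(0, k)] g)

variable {k : ℤ}

theorem tensorType_smul_splitSquare_iff (a q r s t : K) (i : Fin 5) :
    TensorType k (a • splitSquare (0, k) (1, 0) q r s t) i ↔
      SplitType (a * q ^ 2) (a * s ^ 2) (a * t ^ 2) i := by
  have hxy : ((0, k) : Fin 2 × ℤ) ≠ (1, 0) := by simp
  let g : R2 K ⊗[K] R2 K := a • splitSquare (0, k) (1, 0) q r s t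
  have coeff_vu_uv : wcoef₂ [(1, 0), (0, k)] [(0, k), (1, 0)] g = a * (q * q) :=
    wcoef₂_smul_splitSquare hxy a q r s t 3 3
  have coeff_v_v : wcoef₂ [(1, 0)] [(1, 0)] g = a * (s * s) :=
    wcoef₂_smul_splitSquare hxy a q r s t 2 2
  have coeff_u_u : wcoef₂ [(0, k)] [(0, k)] g = a * (t * t) :=
    wcoef₂_smul_splitSquare hxy a q r s t 1 1
  rw [TensorType, coeff_vu_uv, coeff_v_v, coeff_u_u, sq, sq, sq]

theorem diag_translation_splitSquare (μ ν q r s t : K) :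
    diag (translation μ ν) (splitSquare (0, k) (1, 0) q r s t) =
      splitSquare (0, k) (1, 0) q (r + s * ν + t * μ + q * μ * ν) (s + q * μ) (t + q * ν) :=
  diag_splitSquare (FreeAlgebra.lift_ι_apply _ _) (FreeAlgebra.lift_ι_apply _ _) q r s t

theorem tensorType_diag_translation_iff (a q r s t μ ν : K) (i : Fin 5) :
    TensorType k (diag (translation μ ν) (a • splitSquare (0, k) (1, 0) q r s t)) i ↔
      TensorType k (a • splitSquare (0, k) (1, 0) q r s t) i := by
  rw [map_smul, diag_translation_splitSquare, tensorType_smul_splitSquare_iff,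
    tensorType_smul_splitSquare_iff]
  by_cases ha : a = 0
  · simp only [ha, zero_mul]
  · rw [splitType_smul_sq_iff ha, splitType_smul_sq_iff ha, splitType_add_mul_iff]

variable {g : R2 K ⊗[K] R2 K}

theorem diag_translation_neg (μ ν : K) (t : R2 K ⊗[K] R2 K) :
    diag (translation (-μ) (-ν)) (diag (translation μ ν) t) = t := by
  have comp_eq_id : (translation (-μ) (-ν)).comp (translation μ ν) = AlgHom.id K (R2 K) := by
    ext ⟨e, i⟩
    fin_cases e <;> simp [translation]
  have apply_apply (a) : translation (-μ) (-ν) (translation μ ν a) = a :=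
    DFunLike.congr_fun comp_eq_id a
  induction t using TensorProduct.induction_on <;> simp_all

theorem exists_eq_smul_splitSquare_of_normalForm {i : Fin 5} (h : normalForm k g i) :
    ∃ a q r s t : K, g = a • splitSquare (0, k) (1, 0) q r s t ∧ TensorType k g i := by
  suffices ∃ a q r s t : K, g = a • splitSquare (0, k) (1, 0) q r s t ∧
      SplitType (a * q ^ 2) (a * s ^ 2) (a * t ^ 2) i by
    obtain ⟨a, q, r, s, t, rfl, hi⟩ := this
    exact ⟨a, q, r, s, t, rfl, (tensorType_smul_splitSquare_iff ..).2 hi⟩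
  fin_cases i
  · obtain ⟨a, rfl⟩ := h
    exact ⟨a, 0, 1, 0, 0, by simp [smul_splitSquare_quadratic], by simp [SplitType]⟩
  · obtain ⟨a, ha, rfl⟩ := h
    exact ⟨a, 0, 0, 1, 0, by simp [smul_splitSquare_linear, v], by simp [SplitType, ha]⟩
  · obtain ⟨a, ha, rfl⟩ := h
    exact ⟨a, 0, 0, 0, 1, by simp [smul_splitSquare_linear, u], by simp [SplitType, ha]⟩
  · obtain ⟨a, b, ha, hb, rfl⟩ := h
    refine ⟨a, 0, 0, 1, b / a, ?_, by simp [SplitType, ha, hb]⟩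
    have coeff_u_u : a * (b / a) ^ 2 = b ^ 2 / a := by field_simp
    rw [smul_splitSquare_linear, coeff_u_u, one_mul, mul_div_cancel₀ b ha, one_pow, mul_one]
    rfl
  · obtain ⟨a, b, ha, rfl⟩ := h
    refine ⟨a, 1, b / a, 0, 0, ?_, by simp [SplitType, ha]⟩
    have coeff_one_one : a * (b / a) ^ 2 = b ^ 2 / a := by field_simp
    rw [smul_splitSquare_quadratic, coeff_one_one, one_mul, mul_div_cancel₀ b ha, one_pow, mul_one]
    rfl

theorem normalForm_of_linear {a s t : K} {i : Fin 5} (ha : a ≠ 0) (hi : SplitType 0 s t i)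
    (hi_ne : i ≠ 0) : normalForm k (a • splitSquare (0, k) (1, 0) 0 0 s t) i := by
  rw [smul_splitSquare_linear]
  fin_cases i
  · exact absurd rfl hi_ne
  · obtain ⟨-, hs, rfl⟩ := hi
    exact ⟨a * s ^ 2, by positivity, by simp [v]⟩
  · obtain ⟨-, rfl, ht⟩ := hi
    exact ⟨a * t ^ 2, by positivity, by simp [u]⟩
  · obtain ⟨-, hs, ht⟩ := hi
    refine ⟨a * s ^ 2, a * (s * t), by positivity, by positivity, ?_⟩
    have coeff_u_u : (a * (s * t)) ^ 2 / (a * s ^ 2) = a * t ^ 2 := by field_simp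
    rw [coeff_u_u]
    rfl
  · exact absurd rfl hi

theorem normalForm_of_quadratic {a q r : K} (ha : a ≠ 0) (hq : q ≠ 0) :
    normalForm k (a • splitSquare (0, k) (1, 0) q r 0 0) 4 := by
  refine ⟨a * q ^ 2, a * (q * r), by positivity, ?_⟩
  have coeff_one_one : (a * (q * r)) ^ 2 / (a * q ^ 2) = a * r ^ 2 := by field_simp
  rw [smul_splitSquare_quadratic, coeff_one_one]
  rfl

theorem exists_normalForm_diag_translation {a q r s t : K} {i : Fin 5} (ha : a ≠ 0)
    (hi : SplitType q s t i) :
    ∃ μ ν : K, normalForm k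
      (diag (translation μ ν) (a • splitSquare (0, k) (1, 0) q r s t)) i := by
  simp only [map_smul, diag_translation_splitSquare]
  by_cases hq : q = 0
  · subst hq
    by_cases hs : s = 0
    · subst hs
      by_cases ht : t = 0
      · subst ht
        obtain rfl : i = 0 := (existsUnique_splitType 0 0 0).unique hi ⟨rfl, rfl, rfl⟩
        refine ⟨0, 0, a * r ^ 2, ?_⟩
        simp [smul_splitSquare_quadratic]
      · have hr : r + t * (-r / t) = 0 := by field_simp; ring
        refine ⟨-r / t, 0, ?_⟩
        simp only [zero_mul, mul_zero, add_zero, hr]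
        exact normalForm_of_linear ha hi fun hi_zero => ht (hi_zero ▸ hi).2.2
    · have hr : r + s * (-r / s) = 0 := by field_simp; ring
      refine ⟨0, -r / s, ?_⟩
      simp only [zero_mul, mul_zero, add_zero, hr]
      exact normalForm_of_linear ha hi fun hi_zero => hs (hi_zero ▸ hi).2.1
  · obtain rfl : i = 4 := (existsUnique_splitType q s t).unique hi hq
    have hs : s + q * (-s / q) = 0 := by field_simp; ring
    have ht : t + q * (-t / q) = 0 := by field_simp; ring
    refine ⟨-s / q, -t / q, ?_⟩
    rw [hs, ht]
    exact normalForm_of_quadratic ha hq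

theorem exists_normalForm_iff {i : Fin 5} :
    (∃ μ ν : K, normalForm k (diag (translation μ ν) g) i) ↔
      (∃ a q r s t : K, g = a • splitSquare (0, k) (1, 0) q r s t) ∧ TensorType k g i := by
  constructor
  · rintro ⟨μ, ν, h⟩
    obtain ⟨a, q, r, s, t, translate_eq, hi⟩ := exists_eq_smul_splitSquare_of_normalForm h
    rw [translate_eq, ← tensorType_diag_translation_iff a q r s t (-μ) (-ν)] at hi
    rw [← diag_translation_neg μ ν g, translate_eq]
    refine ⟨?_, hi⟩
    rw [map_smul, diag_translation_splitSquare]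
    exact ⟨a, _, _, _, _, rfl⟩
  · rintro ⟨⟨a, q, r, s, t, rfl⟩, hi⟩
    rw [tensorType_smul_splitSquare_iff] at hi
    by_cases ha : a = 0
    · subst ha
      simp only [zero_mul] at hi
      obtain rfl : i = 0 := (existsUnique_splitType 0 0 0).unique hi ⟨rfl, rfl, rfl⟩
      exact ⟨0, 0, 0, by simp⟩
    · exact exists_normalForm_diag_translation ha ((splitType_smul_sq_iff ha q s t i).1 hi)

theorem existsUnique_normalForm_iff :
    (∃! i : Fin 5, ∃ μ ν : K, normalForm k (diag (translation μ ν) g) i) ↔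
      ∃ a q r s t : K, g = a • splitSquare (0, k) (1, 0) q r s t := by
  simp only [exists_normalForm_iff]
  constructor
  · rintro ⟨i, ⟨h, -⟩, -⟩
    exact h
  · intro h
    obtain ⟨i, hi, unique⟩ := existsUnique_splitType (wcoef₂ [(1, 0), (0, k)] [(0, k), (1, 0)] g)
      (wcoef₂ [(1, 0)] [(1, 0)] g) (wcoef₂ [(0, k)] [(0, k)] g)
    exact ⟨i, ⟨h, hi⟩, fun j hj => unique j hj.2⟩

end NormalForms

end DoubleMPVA

end

open DoubleMPVA in
theorem theorem4p9_general (K : Type*) [Field K] (k : ℤ) (g : R2 K ⊗[K] R2 K) :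
    (∃! B : LambdaMap K (R2 K), IsMonomialBracket k g B) ∧
    ∀ B : LambdaMap K (R2 K), IsMonomialBracket k g B →
      (IsDoubleMPVA (shift K) B ↔
        ∃! i : Fin 5, ∃ μ ν : K, normalForm k (diag (translation μ ν) g) i) := by
  refine ⟨existsUnique_isMonomialBracket k g, fun B hB => ?_⟩
  rw [hB.isDoubleMPVA_iff_exists_splitSquare, existsUnique_normalForm_iff]

open DoubleMPVA in
theorem theorem4p9 (K : Type*) [Field K] [CharZero K] (k : ℤ) (g : R2 K ⊗[K] R2 K) :
    (∃! B : LambdaMap K (R2 K), IsMonomialBracket k g B) ∧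
    ∀ B : LambdaMap K (R2 K), IsMonomialBracket k g B →
      (IsDoubleMPVA (shift K) B ↔
        ∃! i : Fin 5, ∃ μ ν : K, normalForm k (diag (translation μ ν) g) i) :=
  theorem4p9_general K k g
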